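/- Let $d\ge 1$. Consider $N$ spins (of arbitrary finite local dimensions) located at the sites of a finite region $\Lambda\subset\mathbb Z^d$, $|\Lambda|=N$, with the Manhattan distance, and let $\|\cdot\|$ be the operator norm. Let $H_0=\sum_\alpha h_\alpha$ be a finite sum of Hermitian operators that is $(a_0,\mathcal Z,J)$-geometrically local ($a_0\ge 1$ an integer, $J\ge 0$): for every $\alpha$, $\operatorname{diam}(\operatorname{supp}h_\alpha)\le a_0$, $|\{\alpha':\operatorname{supp}h_{\alpha'}\cap\operatorname{supp}h_\alpha\ne\emptyset\}|\le\mathcal Z$ and $\|h_\alpha\|\le J$. Suppose that the terms are split into $K$ layers, $H_0=\sum_{j=1}^K H_j$ with $H_j=\sum_{\alpha\in\mathcal A_j}h_\alpha$, where any two terms in the same layer commute. Let $p\ge 1$, and let $r_1,\dots,r_M\in\{1,\dots,K\}$ and $x_1,\dots,x_M\in\mathbb R$ specify a $p$-th order Trotter formula $S(t)=\prod_{j=1}^M e^{-ix_jtH_{r_j}}$, i.e. for all Hermitian operators $H_1,\dots,H_K$ on any finite-dimensional Hilbert space, $\frac{d^k}{dt^k}S(t)\big|_{t=0}=\big(-i\sum_{j=1}^KH_j\big)^k$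 for $k=0,\dots,p$. For an observable $O_X$ supported on $X\subseteq\Lambda$, a density matrix $\rho$, a time $\tau\ge 0$, a number of steps $T\ge 1$ and $\varepsilon=\tau/T$, put $$\Delta=\Big|\operatorname{Tr}\big[O_X\,S(\varepsilon)^T\rho\, S(\varepsilon)^{\dagger T}\big]-\operatorname{Tr}\big[O_X\,e^{-iH_0\tau}\rho\, e^{iH_0\tau}\big]\Big| ,\qquad c_{\mathrm{LR}}=4eJ\mathcal Z a_0 .$$ Then there are a non-decreasing function $\nu_d$ depending only on $d$, with $\nu_d(l)= O(l^d)$ as $l\to\infty$, and a constant $C$ depending only on $d$, $p$ and the Trotter formula, such that $$\Delta\le C\,a_0^{(d-1)(p+1)}\,|X|^2\,\|O_X\|\;c_{\mathrm{LR}}\tau\;\nu_d(c_{\mathrm{LR}}\tau)\,(c_{\mathrm{LR}}\varepsilon)^p .$$ Consequently there are $C'$ and $\tau_0$ depending only on $d$, $p$, the Trotter formula, $a_0$, $\mathcal Z$ and $J$ (in particular not on the system size $N$) such that for all $\tau>\tau_0$ $$\Delta\le C'\,|X|^2\,\|O_X\|\,\tau^{d+1}\varepsilon^p=C'\,|X|^2\,\|O_X\|\,\frac{\tau^{d+p+1}}{T^p}.$$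 -/

import Mathlib

open scoped Matrix.Norms.L2Operator ComplexOrder

noncomputable section

/-- Manhattan distance between two sites of the lattice `ℤ^d`. -/
def siteDist {d : ℕ} (x y : Fin d → ℤ) : ℕ := ∑ i, (x i - y i).natAbs

/-- Basis labels of a system with one spin, of local dimension `q s`, at each site `s` of the
finite region `Λ ⊆ ℤ^d`. -/
abbrev SpinConfig {d : ℕ} (Λ : Finset (Fin d → ℤ)) (q : Λ → ℕ) : Type := (s : Λ) → Fin (q s)

/-- Operators on the Hilbert space `⨂_{s ∈ Λ} ℂ^{q s}`, as matrices in the product basis.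
Their norm `‖·‖` is the operator norm. -/
abbrev SpinOp {d : ℕ} (Λ : Finset (Fin d → ℤ)) (q : Λ → ℕ) : Type :=
  Matrix (SpinConfig Λ q) (SpinConfig Λ q) ℂ

/-- `O` acts as the identity outside `X`: it has the form `A ⊗ 1` with `A` an operator on the
spins in `X`. -/
def IsSupportedOn {d : ℕ} {Λ : Finset (Fin d → ℤ)} {q : Λ → ℕ} (O : SpinOp Λ q)
    (X : Finset Λ) : Prop :=
  ∃ A : Matrix ((s : X) → Fin (q s)) ((s : X) → Fin (q s)) ℂ,
    ∀ σ σ' : SpinConfig Λ q,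
      O σ σ' = if ∀ s, s ∉ X → σ s = σ' s then A (fun s => σ s) (fun s => σ' s) else 0

/-- The support of `O`: the sites at which `O` does not act as the identity. -/
def opSupport {d : ℕ} {Λ : Finset (Fin d → ℤ)} {q : Λ → ℕ} (O : SpinOp Λ q) : Set Λ :=
  {s | ¬ IsSupportedOn O (Finset.univ.erase s)}

/-- The Hermitian operators `h α` are the local terms of an `(a, Z, J)`-geometrically local
Hamiltonian `∑ α, h α`: supports of diameter at most `a`, each support meeting the supports of at
most `Z` terms (the term itself included), norms at most `J`. -/
structure IsGeometricallyLocal {d : ℕ} {Λ : Finset (Fin d → ℤ)} {q : Λ → ℕ} {ι : Type}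
    (a Z : ℕ) (J : ℝ) (h : ι → SpinOp Λ q) : Prop where
  hermitian : ∀ α, (h α).IsHermitian
  diam_le : ∀ α, ∀ s ∈ opSupport (h α), ∀ t ∈ opSupport (h α), siteDist s.1 t.1 ≤ a
  coordination_le : ∀ α, {α' | (opSupport (h α') ∩ opSupport (h α)).Nonempty}.ncard ≤ Z
  norm_le : ∀ α, ‖h α‖ ≤ J

/-- The layer `H_j = ∑_{α ∈ 𝒜_j} h_α` of the Hamiltonian, where `𝒜_j = {α | layer α = j}`. -/
def layerHamiltonian {d : ℕ} {Λ : Finset (Fin d → ℤ)} {q : Λ → ℕ} {ι : Type} [Fintype ι] {K : ℕ}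
    (h : ι → SpinOp Λ q) (layer : ι → Fin K) (j : Fin K) : SpinOp Λ q :=
  ∑ α with layer α = j, h α

/-- The unitary evolution `exp(-i t H)`. -/
def evolution {n : Type} [Fintype n] [DecidableEq n] (H : Matrix n n ℂ) (t : ℝ) : Matrix n n ℂ :=
  NormedSpace.exp ((-(Complex.I * (t : ℂ))) • H)

/-- The product `exp(-i x_1 t H_{r_1}) exp(-i x_2 t H_{r_2}) ⋯ exp(-i x_M t H_{r_M})`. -/
def trotterProduct {n : Type} [Fintype n] [DecidableEq n] {K M : ℕ} (r : Fin M → Fin K)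
    (x : Fin M → ℝ) (H : Fin K → Matrix n n ℂ) (t : ℝ) : Matrix n n ℂ :=
  (List.ofFn fun j : Fin M => evolution (H (r j)) (x j * t)).prod

/-- `(r, x)` specifies a `p`-th order Trotter formula for `exp(-i t (H_1 + ⋯ + H_K))`: for all
Hermitian operators `H_1, …, H_K` on a finite-dimensional Hilbert space, the product and the
exponential have the same derivatives of order `0, …, p` at `t = 0`. -/
def IsTrotterFormula (p : ℕ) {K M : ℕ} (r : Fin M → Fin K) (x : Fin M → ℝ) : Prop :=
  ∀ (n : Type) [Fintype n] [DecidableEq n] (H : Fin K → Matrix n n ℂ),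
    (∀ j, (H j).IsHermitian) → ∀ k ≤ p,
      iteratedDeriv k (trotterProduct r x H) 0 = ((-Complex.I) • ∑ j, H j) ^ k

/-- Density matrices. -/
def IsDensityMatrix {n : Type} [Fintype n] (ρ : Matrix n n ℂ) : Prop :=
  ρ.PosSemidef ∧ ρ.trace = 1

/-- `|Tr(O S(τ/T)^T ρ S(τ/T)^{†T}) - Tr(O exp(-iHτ) ρ exp(iHτ))|` with `H = ∑ j, H_j`: the error
in the expectation of `O` at time `τ` made by `T` steps of the product formula. -/
def trotterError {n : Type} [Fintype n] [DecidableEq n] {K M : ℕ} (r : Fin M → Fin K)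
    (x : Fin M → ℝ) (H : Fin K → Matrix n n ℂ) (O ρ : Matrix n n ℂ) (τ : ℝ) (T : ℕ) : ℝ :=
  ‖(O * (trotterProduct r x H (τ / T) ^ T * ρ * (trotterProduct r x H (τ / T) ^ T).conjTranspose)).trace
    - (O * (evolution (∑ j, H j) τ * ρ * (evolution (∑ j, H j) τ).conjTranspose)).trace‖

/-- The Lieb-Robinson velocity `4 e J Z a` of an `(a, Z, J)`-geometrically local Hamiltonian. -/
def liebRobinsonVelocity (a Z : ℕ) (J : ℝ) : ℝ := 4 * Real.exp 1 * J * Z * a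

end

/-! The product formula `S` solves `S' = -i F S` for a time-dependent Hamiltonian `F`, the
`productGenerator`. Interpolating in the Heisenberg picture between a Trotter step and exact
evolution bounds the error of one step by `ε` times the commutator of the exactly evolved observable
with `F(u) - H₀`, `u ≤ ε` (`norm_productFormula_conj_sub_le`). By unitarity the `T` step errors
simply add, which produces the factor `τ`.

Order `p` means that the derivatives of `F - H₀` of order below `p` vanish at `0`
(`iteratedDeriv_productGenerator_sub`). The norm of `F - H₀` may still grow with the system, so `F`
is split into contributions `F_α` of single terms. Terms of one layer commute, so conjugation by a
layer exponential only involves neighbours: `F_α` lives on an interaction ball of radius `M`, with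
derivatives bounded independently of `N` (`localTo_termGenerator`, `derivBound_termGenerator`). A
single `F_α - h_α` need not vanish to order `p`. But taking the order-`p` Taylor remainder is
linear, fixes `F - H₀` and kills the constant `H₀`; hence `F - H₀` is the sum of the remainders of
the `F_α`, each local and `O(u^p)`.

A Lieb–Robinson bound (`liebRobinson`) suppresses commutators with remote remainders. Interpolated
with the trivial bound it gives exponential decay over the length `c_LR τ + a`, so the sum over `α`
costs a volume `(c_LR τ + a)^d` for each site of `X`
(`norm_lie_heisenberg_productGenerator_sub_le`). One factor `|X|` comes from this sum, the other
from the Lieb–Robinson prefactor. `trotterConstant_bound` then collects the powers of `a` and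
`c_LR`. -/

/-! ### Unitary propagators in a C⋆-algebra -/

section Propagator

variable {A : Type*} [CStarAlgebra A]

/-- The evolution `exp(-i t H)` in a C⋆-algebra. -/
noncomputable def propagator (H : A) (t : ℝ) : A :=
  NormedSpace.exp ((-(Complex.I * (t : ℂ))) • H)

lemma propagator_eq_exp_smul (H : A) (t : ℝ) :
    propagator H t = NormedSpace.exp (t • ((-Complex.I) • H)) := by
  rw [propagator, ← Complex.coe_smul, smul_smul]
  congr 2
  ring

lemma propagator_zero (H : A) : propagator H 0 = 1 := by
  simp [propagator]

lemma Commute.propagator_right {x H : A} (hc : Commute x H) (t : ℝ) :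
    Commute x (propagator H t) :=
  (hc.smul_right _).exp_right

lemma hasDerivAt_propagator (H : A) (t : ℝ) :
    HasDerivAt (propagator H) (((-Complex.I) • H) * propagator H t) t := by
  have h1 := hasDerivAt_exp_smul_const' (𝕂 := ℝ) ((-Complex.I) • H) t
  have h2 : propagator H = fun t : ℝ => NormedSpace.exp (t • ((-Complex.I) • H)) :=
    funext fun t => propagator_eq_exp_smul H t
  rw [h2]
  exact h1

lemma propagator_add_of_commute {H H' : A} (hc : Commute H H') (t : ℝ) :
    propagator (H + H') t = propagator H t * propagator H' t := by
  let _ := NormedAlgebra.restrictScalars ℚ ℂ A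
  rw [propagator, smul_add]
  exact NormedSpace.exp_add_of_commute ((hc.smul_left _).smul_right _)

lemma propagator_add (H : A) (s t : ℝ) :
    propagator H (s + t) = propagator H s * propagator H t := by
  let _ := NormedAlgebra.restrictScalars ℚ ℂ A
  rw [propagator, propagator, propagator, ← NormedSpace.exp_add_of_commute, ← add_smul]
  · congr 2
    push_cast
    ring
  · exact ((Commute.refl H).smul_left _).smul_right _

lemma propagator_mul (H : A) (x t : ℝ) : propagator H (x * t) = propagator (x • H) t := by
  rw [propagator_eq_exp_smul, propagator_eq_exp_smul]
  congr 1
  module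

lemma star_propagator {H : A} (hH : IsSelfAdjoint H) (t : ℝ) :
    star (propagator H t) = propagator H (-t) := by
  rw [propagator, propagator, NormedSpace.star_exp, star_smul, hH.star_eq]
  simp

lemma star_propagator_mul_self {H : A} (hH : IsSelfAdjoint H) (t : ℝ) :
    star (propagator H t) * propagator H t = 1 := by
  rw [star_propagator hH, ← propagator_add, neg_add_cancel, propagator_zero]

lemma propagator_mul_star_self {H : A} (hH : IsSelfAdjoint H) (t : ℝ) :
    propagator H t * star (propagator H t) = 1 := by
  rw [star_propagator hH, ← propagator_add, add_neg_cancel, propagator_zero]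

lemma propagator_mem_unitary {H : A} (hH : IsSelfAdjoint H) (t : ℝ) :
    propagator H t ∈ unitary A :=
  Unitary.mem_iff.2 ⟨star_propagator_mul_self hH t, propagator_mul_star_self hH t⟩

lemma norm_le_one_of_mem_unitary {U : A} (hU : U ∈ unitary A) : ‖U‖ ≤ 1 := by
  rcases subsingleton_or_nontrivial A with h | h
  · simp [Subsingleton.elim U 0]
  · exact (CStarRing.norm_of_mem_unitary hU).le

lemma norm_star_mul_mul_of_mem_unitary {U : A} (hU : U ∈ unitary A) (B : A) :
    ‖star U * B * U‖ = ‖B‖ := by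
  rw [CStarRing.norm_mul_mem_unitary _ hU,
    CStarRing.norm_mem_unitary_mul _ (Unitary.star_mem hU)]

lemma contDiff_propagator (H : A) : ContDiff ℝ (⊤ : ℕ∞) (propagator H) := by
  have h2 : propagator H = fun t : ℝ => NormedSpace.exp (t • ((-Complex.I) • H)) :=
    funext fun t => propagator_eq_exp_smul H t
  have h3 : ContDiff ℝ (⊤ : ℕ∞) (NormedSpace.exp : A → A) :=
    (AnalyticOnNhd.contDiff (𝕜 := ℝ) fun x _ => NormedSpace.exp_analytic x)
  rw [h2]
  exact h3.comp (contDiff_id.smul contDiff_const)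

lemma iteratedDeriv_propagator (H : A) (k : ℕ) :
    iteratedDeriv k (propagator H) = fun t => ((-Complex.I) • H) ^ k * propagator H t := by
  induction k with
  | zero => simp
  | succ k ih =>
    funext t
    rw [iteratedDeriv_succ, ih, pow_succ, mul_assoc]
    exact ((hasDerivAt_propagator H t).const_mul _).deriv

/-- Splitting off from a generator a part that commutes with everything in sight does not change
a conjugation. -/
lemma propagator_conj_eq {H H' g : A} (hH' : IsSelfAdjoint H')
    (hc : Commute H H') (hg : Commute g H') (t : ℝ) :
    propagator (H + H') t * g * star (propagator (H + H') t)
      = propagator H t * g * star (propagator H t) := by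
  rw [propagator_add_of_commute hc, star_mul]
  have h1 : propagator H' t * g = g * propagator H' t := (hg.propagator_right t).eq.symm
  calc propagator H t * propagator H' t * g * (star (propagator H' t) * star (propagator H t))
      = propagator H t * (propagator H' t * g) * star (propagator H' t)
          * star (propagator H t) := by simp only [mul_assoc]
    _ = propagator H t * g * (propagator H' t * star (propagator H' t))
          * star (propagator H t) := by rw [h1]; simp only [mul_assoc]
    _ = _ := by rw [propagator_mul_star_self hH', mul_one]

end Propagator

/-! ### Smooth curves with geometrically bounded derivatives -/

section DerivBound

variable {A : Type*} [CStarAlgebra A]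

/-- A smooth curve whose `k`-th derivative is bounded by `b * a ^ k`. -/
structure DerivBound (a b : ℝ) (g : ℝ → A) : Prop where
  contDiff : ContDiff ℝ (⊤ : ℕ∞) g
  bound : ∀ k t, ‖iteratedDeriv k g t‖ ≤ b * a ^ k

lemma ContDiff.at_nat {g : ℝ → A} (hg : ContDiff ℝ (⊤ : ℕ∞) g) (k : ℕ) (t : ℝ) :
    ContDiffAt ℝ k g t :=
  (hg.of_le (by exact_mod_cast le_top)).contDiffAt

lemma DerivBound.const {a b : ℝ} (ha : 0 ≤ a) {c : A} (hc : ‖c‖ ≤ b) :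
    DerivBound a b (fun _ => c) := by
  refine ⟨contDiff_const, fun k t => ?_⟩
  have hb : 0 ≤ b := (norm_nonneg c).trans hc
  rw [iteratedDeriv_const]
  split_ifs with hk
  · simpa [hk] using hc
  · rw [norm_zero]; positivity

lemma DerivBound.add {a b b' : ℝ} {f g : ℝ → A} (hf : DerivBound a b f)
    (hg : DerivBound a b' g) : DerivBound a (b + b') (fun t => f t + g t) := by
  refine ⟨hf.contDiff.add hg.contDiff, fun k t => ?_⟩
  have := iteratedDeriv_add (hf.contDiff.at_nat k t) (hg.contDiff.at_nat k t)
  rw [show (fun t => f t + g t) = f + g from rfl, this, add_mul]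
  exact (norm_add_le _ _).trans (add_le_add (hf.bound k t) (hg.bound k t))

/-- The Leibniz rule matches the binomial theorem: rates add while amplitudes multiply. -/
lemma DerivBound.mul {a a' b b' : ℝ} {f g : ℝ → A} (ha : 0 ≤ a) (hb : 0 ≤ b)
    (hf : DerivBound a b f)
    (hg : DerivBound a' b' g) : DerivBound (a + a') (b * b') (fun t => f t * g t) := by
  refine ⟨hf.contDiff.mul hg.contDiff, fun k t => ?_⟩
  have := iteratedDeriv_mul (hf.contDiff.at_nat k t) (hg.contDiff.at_nat k t)
  rw [show (fun t => f t * g t) = f * g from rfl, this, add_pow, Finset.mul_sum]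
  refine (norm_sum_le _ _).trans (Finset.sum_le_sum fun i _ => ?_)
  rw [mul_assoc, ← nsmul_eq_mul]
  refine (norm_nsmul_le).trans ?_
  have h1 : ‖iteratedDeriv i f t * iteratedDeriv (k - i) g t‖
      ≤ (b * a ^ i) * (b' * a' ^ (k - i)) :=
    (norm_mul_le _ _).trans (mul_le_mul (hf.bound i t) (hg.bound _ t) (norm_nonneg _)
      (mul_nonneg hb (pow_nonneg ha i)))
  calc (k.choose i : ℝ) * ‖iteratedDeriv i f t * iteratedDeriv (k - i) g t‖
      ≤ (k.choose i : ℝ) * ((b * a ^ i) * (b' * a' ^ (k - i))) := by gcongr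
    _ = _ := by ring

lemma DerivBound.propagator {H : A} (hH : IsSelfAdjoint H) {a : ℝ} (ha : ‖H‖ ≤ a) :
    DerivBound a 1 (propagator H) := by
  refine ⟨contDiff_propagator H, fun k t => ?_⟩
  simp only [iteratedDeriv_propagator]
  have h1 := norm_le_one_of_mem_unitary (propagator_mem_unitary hH t)
  rw [one_mul]
  -- The zero algebra is treated apart because `norm_pow_le` needs `‖1‖ = 1`.
  rcases subsingleton_or_nontrivial A with h | h
  · rw [Subsingleton.elim (((-Complex.I) • H) ^ k * _root_.propagator H t) 0, norm_zero]
    exact pow_nonneg ((norm_nonneg H).trans ha) k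
  · calc ‖((-Complex.I) • H) ^ k * _root_.propagator H t‖
        ≤ ‖((-Complex.I) • H) ^ k‖ * ‖_root_.propagator H t‖ := norm_mul_le _ _
      _ ≤ ‖(-Complex.I) • H‖ ^ k * 1 := by
          gcongr
          exact norm_pow_le _ _
      _ = ‖H‖ ^ k := by rw [norm_smul]; simp
      _ ≤ a ^ k := by gcongr

lemma DerivBound.star_propagator {H : A} (hH : IsSelfAdjoint H) {a : ℝ} (ha : ‖H‖ ≤ a) :
    DerivBound a 1 (fun t => star (_root_.propagator H t)) := by
  have h1 : (fun t => star (_root_.propagator H t)) = _root_.propagator (-H) := by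
    funext t
    rw [_root_.star_propagator hH, _root_.propagator, _root_.propagator]
    simp
  rw [h1]
  exact DerivBound.propagator hH.neg (by rwa [norm_neg])

end DerivBound

/-! ### Taylor remainders -/

section TaylorRem

variable {E : Type*} [NormedAddCommGroup E] [NormedSpace ℝ E]

/-- The remainder at `t` of the Taylor expansion of `g` at `0` up to order `p - 1`. -/
noncomputable def taylorRem (p : ℕ) (g : ℝ → E) (t : ℝ) : E :=
  g t - ∑ k ∈ Finset.range p, (t ^ k / k.factorial) • iteratedDeriv k g 0

lemma taylorRem_succ_zero (p : ℕ) (g : ℝ → E) : taylorRem (p + 1) g 0 = 0 := by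
  simp [taylorRem, Finset.sum_range_succ']

lemma hasDerivAt_taylorRem (p : ℕ) {g : ℝ → E} (hg : ContDiff ℝ (⊤ : ℕ∞) g) (t : ℝ) :
    HasDerivAt (taylorRem (p + 1) g) (taylorRem p (deriv g) t) t := by
  have h0 : HasDerivAt g (deriv g t) t :=
    (hg.differentiable (by simp)).differentiableAt.hasDerivAt
  have h1 : HasDerivAt
      (fun s : ℝ => ∑ k ∈ Finset.range (p + 1), (s ^ k / k.factorial) • iteratedDeriv k g 0)
      (∑ k ∈ Finset.range (p + 1),
        ((k * t ^ (k - 1)) / k.factorial) • iteratedDeriv k g 0) t := by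
    refine HasDerivAt.fun_sum fun k _ => ?_
    exact ((hasDerivAt_pow k t).div_const _).smul_const _
  have h2 : HasDerivAt (taylorRem (p + 1) g) _ t := h0.sub h1
  convert h2 using 1
  rw [taylorRem, Finset.sum_range_succ']
  simp only [Nat.cast_zero, zero_mul, zero_div, zero_smul, add_zero]
  congr 1
  refine Finset.sum_congr rfl fun k _ => ?_
  rw [← iteratedDeriv_succ']
  congr 1
  rw [Nat.factorial_succ, Nat.add_sub_cancel]
  push_cast
  field_simp

/-- The derivative of the remainder of `g` is the remainder of `g'` one order lower, so the mean
value inequality gains one power of `t` per induction step. The factor `1 / p!` is given up. -/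
lemma norm_taylorRem_le (p : ℕ) {g : ℝ → E} (hg : ContDiff ℝ (⊤ : ℕ∞) g) {C : ℝ}
    (hC : ∀ s, ‖iteratedDeriv p g s‖ ≤ C) {t : ℝ} (ht : 0 ≤ t) :
    ‖taylorRem p g t‖ ≤ C * t ^ p := by
  induction p generalizing g t with
  | zero => simpa [taylorRem] using hC t
  | succ p ih =>
    have hC0 : 0 ≤ C := (norm_nonneg _).trans (hC 0)
    have hg' : ContDiff ℝ (⊤ : ℕ∞) (deriv g) :=
      (contDiff_infty_iff_deriv.1 hg).2
    have hb : ∀ s ∈ Set.Ico (0 : ℝ) t, ‖taylorRem p (deriv g) s‖ ≤ C * t ^ p := by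
      intro s hs
      refine (ih hg' (fun u => ?_) hs.1).trans ?_
      · rw [← iteratedDeriv_succ']; exact hC u
      · have := pow_le_pow_left₀ hs.1 hs.2.le p
        gcongr
    have := norm_image_sub_le_of_norm_deriv_le_segment'
      (fun s _ => (hasDerivAt_taylorRem p hg s).hasDerivWithinAt) hb t
      (Set.right_mem_Icc.2 ht)
    rw [taylorRem_succ_zero, sub_zero, sub_zero] at this
    rwa [pow_succ, ← mul_assoc]

lemma taylorRem_const {p : ℕ} (hp : 1 ≤ p) (c : E) (t : ℝ) :
    taylorRem p (fun _ => c) t = 0 := by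
  obtain ⟨p, rfl⟩ := Nat.exists_eq_add_of_le' hp
  simp [taylorRem, iteratedDeriv_const]

/-- Together with `taylorRem_const` and additivity, this turns the vanishing of a sum to order `p`
into an expression by remainders of its summands, none of which has to vanish itself. -/
lemma taylorRem_eq_self {p : ℕ} {g : ℝ → E} (h0 : ∀ k < p, iteratedDeriv k g 0 = 0) (t : ℝ) :
    taylorRem p g t = g t := by
  rw [taylorRem, Finset.sum_eq_zero, sub_zero]
  intro k hk
  rw [h0 k (Finset.mem_range.1 hk), smul_zero]

lemma taylorRem_sum {ι : Type*} (p : ℕ) (s : Finset ι) {g : ι → ℝ → E}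
    (hg : ∀ i ∈ s, ContDiff ℝ (⊤ : ℕ∞) (g i)) (t : ℝ) :
    taylorRem p (fun t => ∑ i ∈ s, g i t) t = ∑ i ∈ s, taylorRem p (g i) t := by
  simp only [taylorRem, Finset.sum_sub_distrib]
  congr 1
  rw [Finset.sum_comm]
  refine Finset.sum_congr rfl fun k _ => ?_
  rw [iteratedDeriv_fun_sum fun i hi =>
    ((hg i hi).of_le (by exact_mod_cast le_top)).contDiffAt, Finset.smul_sum]

lemma taylorRem_sub (p : ℕ) {f g : ℝ → E} (hf : ContDiff ℝ (⊤ : ℕ∞) f)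
    (hg : ContDiff ℝ (⊤ : ℕ∞) g) (t : ℝ) :
    taylorRem p (fun t => f t - g t) t = taylorRem p f t - taylorRem p g t := by
  have h : ∀ k : ℕ, iteratedDeriv k (fun t => f t - g t) 0
      = iteratedDeriv k f 0 - iteratedDeriv k g 0 := fun k =>
    iteratedDeriv_fun_sub (hf.of_le (by exact_mod_cast le_top)).contDiffAt
      (hg.of_le (by exact_mod_cast le_top)).contDiffAt
  simp only [taylorRem, h, smul_sub, Finset.sum_sub_distrib]
  abel

end TaylorRem

/-! ### Commutants and vanishing order under differentiation -/

section TaylorRemCommute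

variable {A : Type*} [CStarAlgebra A]

/-- Differentiate `W g = g W`. Locality is expressed through commutants, so this is what makes it
pass to Taylor remainders. -/
lemma Commute.iteratedDeriv_right {W : A} {g : ℝ → A} (hg : ContDiff ℝ (⊤ : ℕ∞) g)
    (hW : ∀ t, Commute W (g t)) (k : ℕ) (t : ℝ) : Commute W (iteratedDeriv k g t) := by
  induction k generalizing g t with
  | zero => simpa using hW t
  | succ k ih =>
    rw [iteratedDeriv_succ']
    refine ih (contDiff_infty_iff_deriv.1 hg).2 (fun s => ?_) t
    have h0 : HasDerivAt g (deriv g s) s :=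
      (hg.differentiable (by simp)).differentiableAt.hasDerivAt
    have h1 := h0.const_mul W
    have h2 := h0.mul_const W
    have h3 : (fun s => W * g s) = fun s => g s * W := funext fun s => (hW s).eq
    rw [h3] at h1
    exact h1.unique h2

lemma Commute.taylorRem_right {W : A} {g : ℝ → A} (hg : ContDiff ℝ (⊤ : ℕ∞) g)
    (hW : ∀ t, Commute W (g t)) (p : ℕ) (t : ℝ) : Commute W (taylorRem p g t) := by
  refine (hW t).sub_right (Commute.sum_right _ _ _ fun k _ => ?_)
  exact (Commute.iteratedDeriv_right hg hW k 0).smul_right _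

lemma iteratedDeriv_mul_eq_zero {p : ℕ} {f g : ℝ → A} (hf : ContDiff ℝ (⊤ : ℕ∞) f)
    (hg : ContDiff ℝ (⊤ : ℕ∞) g) (h0 : ∀ k < p, iteratedDeriv k f 0 = 0) :
    ∀ k < p, iteratedDeriv k (fun t => f t * g t) 0 = 0 := by
  intro k hk
  rw [iteratedDeriv_fun_mul (hf.at_nat k 0) (hg.at_nat k 0)]
  refine Finset.sum_eq_zero fun i hi => ?_
  rw [h0 i (by have := Finset.mem_range.1 hi; omega)]
  simp

end TaylorRemCommute

/-! ### Product formulas and their generators -/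

section ProductFormula

variable {A κ : Type*} [CStarAlgebra A]

/-- The product `exp(-i x_1 t H_{r_1}) ⋯ exp(-i x_M t H_{r_M})` given by a list of pairs
`(r_j, x_j)`. -/
noncomputable def productFormula (H : κ → A) : List (κ × ℝ) → ℝ → A
  | [], _ => 1
  | (r, x) :: L, t => propagator (H r) (x * t) * productFormula H L t

/-- The time-dependent Hamiltonian `F` generating a product formula `S`, so that `dS/dt = -i F S`. -/
noncomputable def productGenerator (H : κ → A) : List (κ × ℝ) → ℝ → A
  | [], _ => 0
  | (r, x) :: L, t => x • H r
      + propagator (H r) (x * t) * productGenerator H L t * star (propagator (H r) (x * t))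

variable {H : κ → A}

lemma productFormula_mem_unitary (hH : ∀ r, IsSelfAdjoint (H r))
    (L : List (κ × ℝ)) (t : ℝ) :
    productFormula H L t ∈ unitary A := by
  induction L with
  | nil => exact one_mem _
  | cons y L ih => exact mul_mem (propagator_mem_unitary (hH _) _) ih

lemma productGenerator_isSelfAdjoint (hH : ∀ r, IsSelfAdjoint (H r))
    (L : List (κ × ℝ)) (t : ℝ) :
    IsSelfAdjoint (productGenerator H L t) := by
  induction L with
  | nil => exact IsSelfAdjoint.zero A
  | cons y L ih =>
    refine IsSelfAdjoint.add ?_ (ih.conjugate _)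
    exact IsSelfAdjoint.smul (IsSelfAdjoint.all _) (hH _)

lemma contDiff_propagator_mul (H : A) (x : ℝ) :
    ContDiff ℝ (⊤ : ℕ∞) (fun t => propagator H (x * t)) :=
  (contDiff_propagator H).comp (contDiff_const.mul contDiff_id)

lemma contDiff_star {g : ℝ → A} (hg : ContDiff ℝ (⊤ : ℕ∞) g) :
    ContDiff ℝ (⊤ : ℕ∞) (fun t => star (g t)) :=
  (starL' ℝ : A ≃L[ℝ] A).contDiff.comp hg

lemma contDiff_productFormula (L : List (κ × ℝ)) :
    ContDiff ℝ (⊤ : ℕ∞) (productFormula H L) := by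
  induction L with
  | nil => exact contDiff_const
  | cons y L ih => exact (contDiff_propagator_mul _ _).mul ih

lemma contDiff_productGenerator (L : List (κ × ℝ)) :
    ContDiff ℝ (⊤ : ℕ∞) (productGenerator H L) := by
  induction L with
  | nil => exact contDiff_const
  | cons y L ih =>
    exact contDiff_const.add
      (((contDiff_propagator_mul _ _).mul ih).mul (contDiff_star (contDiff_propagator_mul _ _)))

/-- Differentiating the head factor produces `x • H r`; inserting `U⋆ U = 1` after the generator of
the tail produces its conjugate by the head factor `U`. -/
lemma hasDerivAt_productFormula (hH : ∀ r, IsSelfAdjoint (H r))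
    (L : List (κ × ℝ)) (t : ℝ) :
    HasDerivAt (productFormula H L)
      ((-Complex.I) • (productGenerator H L t * productFormula H L t)) t := by
  induction L with
  | nil => simpa [productFormula, productGenerator] using hasDerivAt_const t (1 : A)
  | cons y L ih =>
    obtain ⟨r, x⟩ := y
    have h1 : HasDerivAt (fun t => propagator (H r) (x * t))
        (((-Complex.I) • (x • H r)) * propagator (H r) (x * t)) t := by
      have h2 := hasDerivAt_propagator (x • H r) t
      simp only [propagator_mul]
      exact h2
    refine (h1.mul ih).congr_deriv ?_
    simp only [productGenerator, productFormula, add_mul, smul_add, mul_smul_comm,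
      smul_mul_assoc]
    congr 2
    · simp only [mul_assoc]
    · calc _ = propagator (H r) (x * t) * productGenerator H L t * 1 * productFormula H L t := by
            rw [mul_one, mul_assoc]
        _ = _ := by
            rw [← star_propagator_mul_self (hH r) (x * t)]
            simp only [mul_assoc]

lemma iteratedDeriv_left_mul {f : ℝ → A} (hf : ContDiff ℝ (⊤ : ℕ∞) f) (c : A) (k : ℕ) :
    iteratedDeriv k (fun t => c * f t) = fun t => c * iteratedDeriv k f t := by
  induction k generalizing f with
  | zero => simp
  | succ k ih =>
    rw [iteratedDeriv_succ', iteratedDeriv_succ', ← ih (contDiff_infty_iff_deriv.1 hf).2]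
    congr 1
    funext t
    exact (((hf.differentiable (by simp)).differentiableAt.hasDerivAt).const_mul c).deriv

/-- The defect `V = S' + i H₀ S` vanishes to order `p` since `S` has the right derivatives up to
order `p`, and `F - H₀ = i V S⋆`. Multiplication by a smooth factor keeps the order of vanishing. -/
lemma iteratedDeriv_productGenerator_sub (hH : ∀ r, IsSelfAdjoint (H r))
    {H₀ : A} {p : ℕ} {L : List (κ × ℝ)}
    (hp : ∀ k ≤ p, iteratedDeriv k (productFormula H L) 0 = ((-Complex.I) • H₀) ^ k) :
    ∀ k < p, iteratedDeriv k (fun t => productGenerator H L t - H₀) 0 = 0 := by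
  have hS := contDiff_productFormula (H := H) L
  have hS' : ContDiff ℝ (⊤ : ℕ∞) (deriv (productFormula H L)) :=
    (contDiff_infty_iff_deriv.1 hS).2
  set V : ℝ → A := fun t =>
    deriv (productFormula H L) t - ((-Complex.I) • H₀) * productFormula H L t with hV
  have hVc : ContDiff ℝ (⊤ : ℕ∞) V := hS'.sub (contDiff_const.mul hS)
  have hV0 : ∀ k < p, iteratedDeriv k V 0 = 0 := by
    intro k hk
    have h1 : iteratedDeriv k (fun t => ((-Complex.I) • H₀) * productFormula H L t) 0
        = ((-Complex.I) • H₀) * iteratedDeriv k (productFormula H L) 0 :=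
      congrFun (iteratedDeriv_left_mul hS _ k) 0
    rw [hV, iteratedDeriv_fun_sub (hS'.at_nat k 0) ((contDiff_const.mul hS).at_nat k 0), h1,
      ← iteratedDeriv_succ', hp k hk.le, hp (k + 1) hk, pow_succ', sub_self]
  have hR : (fun t => productGenerator H L t - H₀)
      = fun t => V t * (Complex.I • star (productFormula H L t)) := by
    funext t
    have hU := productFormula_mem_unitary hH L t
    simp only [hV]
    rw [(hasDerivAt_productFormula hH L t).deriv, smul_mul_assoc, ← smul_sub, ← sub_mul,
      smul_mul_assoc, mul_smul_comm, mul_assoc, Unitary.mul_star_self_of_mem hU, smul_smul]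
    simp
  rw [hR]
  exact iteratedDeriv_mul_eq_zero hVc
    ((contDiff_star hS).const_smul Complex.I) hV0

end ProductFormula

/-! ### Locality of the generator for layered Hamiltonians -/

section Locality

open Classical in
/-- The set `S` together with all neighbours of its elements. -/
noncomputable def thicken {ι : Type*} [Fintype ι] (adj : ι → ι → Prop) (S : Finset ι) :
    Finset ι :=
  {β | β ∈ S ∨ ∃ γ ∈ S, adj γ β}

/-- The ball of radius `m` about `α` in the interaction graph. -/
noncomputable def interactionBall {ι : Type*} [Fintype ι] (adj : ι → ι → Prop) (α : ι) :
    ℕ → Finset ι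
  | 0 => {α}
  | m + 1 => thicken adj (interactionBall adj α m)

lemma subset_thicken {ι : Type*} [Fintype ι] (adj : ι → ι → Prop) (S : Finset ι) :
    S ⊆ thicken adj S := fun β hβ => by simp [thicken, hβ]

lemma mem_interactionBall_self {ι : Type*} [Fintype ι] (adj : ι → ι → Prop) (α : ι) (m : ℕ) :
    α ∈ interactionBall adj α m := by
  induction m with
  | zero => simp [interactionBall]
  | succ m ih => exact subset_thicken _ _ ih

/-- The total weight `∑ |x_j|` of a product formula. -/
def formulaWeight {κ : Type*} (L : List (κ × ℝ)) : ℝ := (L.map fun y => |y.2|).sum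

lemma formulaWeight_nonneg {κ : Type*} (L : List (κ × ℝ)) : 0 ≤ formulaWeight L :=
  List.sum_nonneg fun y hy => by
    obtain ⟨z, -, rfl⟩ := List.mem_map.1 hy
    exact abs_nonneg _

lemma isSelfAdjoint_finset_sum {A ι : Type*} [CStarAlgebra A] {s : Finset ι} {h : ι → A} (hh : ∀ α, IsSelfAdjoint (h α)) :
    IsSelfAdjoint (∑ α ∈ s, h α) := by
  rw [IsSelfAdjoint, star_sum]
  exact Finset.sum_congr rfl fun α _ => (hh α).star_eq

lemma norm_finset_sum_le_card {A ι : Type*} [CStarAlgebra A] {s : Finset ι} {h : ι → A} {J : ℝ} (hJ : ∀ α, ‖h α‖ ≤ J) :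
    ‖∑ α ∈ s, h α‖ ≤ s.card * J := by
  simpa using norm_sum_le_of_le s fun α _ => hJ α

variable {A ι κ : Type*} [CStarAlgebra A] [Fintype ι] [DecidableEq κ]

/-- The values of `g` commute with everything that commutes with the terms in `S`. -/
def LocalTo (h : ι → A) (S : Finset ι) (g : ℝ → A) : Prop :=
  ∀ W, (∀ β ∈ S, Commute W (h β)) → ∀ t, Commute W (g t)

/-- The sum of the terms in a layer. -/
def layerSum (h : ι → A) (layer : ι → κ) (r : κ) : A := ∑ α with layer α = r, h α

/-- The contribution of the term `h α` to the generator of a product formula. -/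
noncomputable def termGenerator (h : ι → A) (layer : ι → κ) (α : ι) : List (κ × ℝ) → ℝ → A
  | [], _ => 0
  | (r, x) :: L, t => (if layer α = r then x • h α else 0)
      + propagator (layerSum h layer r) (x * t) * termGenerator h layer α L t
        * star (propagator (layerSum h layer r) (x * t))

lemma productGenerator_eq_sum (h : ι → A) (layer : ι → κ) (L : List (κ × ℝ)) (t : ℝ) :
    productGenerator (layerSum h layer) L t = ∑ α, termGenerator h layer α L t := by
  induction L with
  | nil => simp [productGenerator, termGenerator]
  | cons y L ih =>
    simp only [productGenerator, termGenerator, ih, Finset.sum_add_distrib, Finset.mul_sum,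
      Finset.sum_mul]
    congr 1
    rw [layerSum, Finset.smul_sum, Finset.sum_filter]

variable {h : ι → A} {layer : ι → κ} {adj : ι → ι → Prop}

/-- A layer acts on a local operator through finitely many of its terms. -/
lemma LocalTo.layer_conj_eq (hh : ∀ α, IsSelfAdjoint (h α))
    (hlayer : ∀ α β, layer α = layer β → Commute (h α) (h β))
    (hadj : ∀ α β, ¬ adj α β → Commute (h α) (h β))
    {S : Finset ι} {g : ℝ → A} (hg : LocalTo h S g) (r : κ) (s t : ℝ) :
    propagator (layerSum h layer r) s * g t * star (propagator (layerSum h layer r) s)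
      = propagator (∑ β ∈ thicken adj S with layer β = r, h β) s * g t
        * star (propagator (∑ β ∈ thicken adj S with layer β = r, h β) s) := by
  classical
  have hsplit : layerSum h layer r = (∑ β ∈ thicken adj S with layer β = r, h β)
      + ∑ β ∈ Finset.univ \ thicken adj S with layer β = r, h β := by
    rw [layerSum, add_comm, Finset.sum_filter, Finset.sum_filter, Finset.sum_filter,
      Finset.sum_sdiff (Finset.subset_univ _)]
  rw [hsplit]
  refine propagator_conj_eq (isSelfAdjoint_finset_sum hh) ?_ ?_ s
  · refine Commute.sum_left _ _ _ fun β hβ => Commute.sum_right _ _ _ fun γ hγ => ?_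
    exact hlayer _ _ ((Finset.mem_filter.1 hβ).2.trans (Finset.mem_filter.1 hγ).2.symm)
  · refine Commute.sum_right _ _ _ fun β hβ => ?_
    -- A term outside the thickening has no neighbour in `S`, so it commutes with all terms of `S`
    -- and hence with `g t`.
    refine (hg (h β) (fun γ hγ => (hadj γ β fun hc => ?_).symm) t).symm
    have h1 := (Finset.mem_sdiff.1 (Finset.mem_filter.1 hβ).1).2
    exact h1 (by simp only [thicken, Finset.mem_filter, Finset.mem_univ, true_and]
                 exact Or.inr ⟨γ, hγ, hc⟩)

/-- By `LocalTo.layer_conj_eq` each factor of the product formula enlarges the region by one step of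
the interaction graph; hence the radius is the number of factors. -/
lemma localTo_termGenerator (hh : ∀ α, IsSelfAdjoint (h α))
    (hlayer : ∀ α β, layer α = layer β → Commute (h α) (h β))
    (hadj : ∀ α β, ¬ adj α β → Commute (h α) (h β))
    (α : ι) (L : List (κ × ℝ)) :
    LocalTo h (interactionBall adj α L.length) (termGenerator h layer α L) := by
  induction L with
  | nil => exact fun W _ t => Commute.zero_right W
  | cons y L ih =>
    obtain ⟨r, x⟩ := y
    intro W hW t
    have hW' : Commute W (∑ β ∈ thicken adj (interactionBall adj α L.length) with layer β = r,
        h β) :=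
      Commute.sum_right _ _ _ fun β hβ => hW β (Finset.mem_filter.1 hβ).1
    refine Commute.add_right ?_ ?_
    · split_ifs
      · exact (hW α (mem_interactionBall_self _ _ _)).smul_right x
      · exact Commute.zero_right W
    · rw [ih.layer_conj_eq hh hlayer hadj]
      refine ((hW'.propagator_right _).mul_right
        (ih W (fun β hβ => hW β (subset_thicken _ _ hβ)) t)).mul_right ?_
      rw [star_propagator (isSelfAdjoint_finset_sum hh)]
      exact hW'.propagator_right _

lemma interactionBall_card_mono (α : ι) {m n : ℕ} (hmn : m ≤ n) :
    (interactionBall adj α m).card ≤ (interactionBall adj α n).card := by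
  induction hmn with
  | refl => rfl
  | step _ ih => exact ih.trans (Finset.card_le_card (subset_thicken _ _))

/-- Each layer may be replaced by its part `Hin` near the region already reached, whose norm is at
most `J * N` whatever the system size. The two exponentials of a conjugation then add `2 |x| J N` to
the rate, and the new summand adds `J |x|` to the amplitude. -/
lemma derivBound_termGenerator (hh : ∀ α, IsSelfAdjoint (h α))
    (hlayer : ∀ α β, layer α = layer β → Commute (h α) (h β))
    (hadj : ∀ α β, ¬ adj α β → Commute (h α) (h β))
    {J N : ℝ} (hJ : ∀ α, ‖h α‖ ≤ J) (hJ0 : 0 ≤ J) (α : ι)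
    (L : List (κ × ℝ)) (hN : ((interactionBall adj α L.length).card : ℝ) ≤ N) :
    DerivBound (2 * (J * N) * formulaWeight L) (J * formulaWeight L)
      (termGenerator h layer α L) := by
  induction L with
  | nil =>
    have := DerivBound.const (A := A) (a := 0) (b := 0) le_rfl (c := 0) (by simp)
    simp only [formulaWeight, List.map_nil, List.sum_nil, mul_zero]
    exact this
  | cons y L ih =>
    obtain ⟨r, x⟩ := y
    have hN' : ((interactionBall adj α L.length).card : ℝ) ≤ N :=
      le_trans (by exact_mod_cast interactionBall_card_mono α (Nat.le_succ _)) hN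
    have hN0 : 0 ≤ N := (Nat.cast_nonneg _).trans hN
    have hw := formulaWeight_nonneg L
    have ih := ih hN'
    set Hin : A := ∑ β ∈ thicken adj (interactionBall adj α L.length) with layer β = r, h β
      with hHin
    have hsa : IsSelfAdjoint (x • Hin) :=
      IsSelfAdjoint.smul (IsSelfAdjoint.all _) (isSelfAdjoint_finset_sum hh)
    have hnorm : ‖x • Hin‖ ≤ |x| * (J * N) := by
      rw [norm_smul, Real.norm_eq_abs]
      refine mul_le_mul_of_nonneg_left ?_ (abs_nonneg _)
      refine (norm_finset_sum_le_card hJ).trans ?_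
      rw [mul_comm]
      refine mul_le_mul_of_nonneg_left (le_trans ?_ hN) hJ0
      exact_mod_cast Finset.card_le_card (Finset.filter_subset _ _)
    have h1 : DerivBound (2 * (J * N) * (|x| + formulaWeight L)) (|x| * J)
        (fun _ => if layer α = r then x • h α else 0) := by
      refine DerivBound.const (by positivity) ?_
      split_ifs
      · rw [norm_smul, Real.norm_eq_abs]
        exact mul_le_mul_of_nonneg_left (hJ α) (abs_nonneg _)
      · rw [norm_zero]; positivity
    have h2 : DerivBound (|x| * (J * N) + 2 * (J * N) * formulaWeight L + |x| * (J * N))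
        (1 * (J * formulaWeight L) * 1)
        (fun t => propagator (x • Hin) t * termGenerator h layer α L t
          * star (propagator (x • Hin) t)) :=
      DerivBound.mul (by positivity) (by positivity)
        (DerivBound.mul (by positivity) zero_le_one (DerivBound.propagator hsa hnorm) ih)
        (DerivBound.star_propagator hsa hnorm)
    have h3 : termGenerator h layer α ((r, x) :: L) = fun t =>
        (if layer α = r then x • h α else 0) + propagator (x • Hin) t
          * termGenerator h layer α L t * star (propagator (x • Hin) t) := by
      funext t
      rw [termGenerator, (localTo_termGenerator hh hlayer hadj α L).layer_conj_eq hh hlayer hadj,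
        propagator_mul]
    have hwc : formulaWeight ((r, x) :: L) = |x| + formulaWeight L := by simp [formulaWeight]
    rw [h3, hwc]
    rw [show |x| * (J * N) + 2 * (J * N) * formulaWeight L + |x| * (J * N)
      = 2 * (J * N) * (|x| + formulaWeight L) by ring] at h2
    have h4 := h1.add h2
    rwa [show |x| * J + 1 * (J * formulaWeight L) * 1 = J * (|x| + formulaWeight L) by ring]
      at h4

end Locality

/-! ### Lieb–Robinson bounds -/

section LiebRobinson

variable {A : Type*} [CStarAlgebra A]

/-- The Heisenberg evolution `exp(i t H) O exp(-i t H)`. -/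
noncomputable def heisenberg (H : A) (t : ℝ) (O : A) : A :=
  star (propagator H t) * O * propagator H t

lemma heisenberg_zero (H O : A) : heisenberg H 0 O = O := by
  simp [heisenberg, propagator_zero]

lemma norm_heisenberg {H : A} (hH : IsSelfAdjoint H) (t : ℝ) (O : A) :
    ‖heisenberg H t O‖ = ‖O‖ :=
  norm_star_mul_mul_of_mem_unitary (propagator_mem_unitary hH t) O

lemma heisenberg_sum {ι : Type*} (H : A) (t : ℝ) (s : Finset ι) (h : ι → A) :
    heisenberg H t (∑ α ∈ s, h α) = ∑ α ∈ s, heisenberg H t (h α) := by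
  simp only [heisenberg, Finset.mul_sum, Finset.sum_mul]

lemma hasDerivAt_star_propagator {H : A} (hH : IsSelfAdjoint H) (t : ℝ) :
    HasDerivAt (fun t => star (propagator H t))
      (star (propagator H t) * (Complex.I • H)) t := by
  have h1 := (hasDerivAt_propagator H t).star
  refine h1.congr_deriv ?_
  rw [star_mul, star_smul, hH.star_eq]
  simp

lemma hasDerivAt_heisenberg {H : A} (hH : IsSelfAdjoint H) (O : A) (t : ℝ) :
    HasDerivAt (fun t => heisenberg H t O) (Complex.I • ⁅H, heisenberg H t O⁆) t := by
  have h1 := ((hasDerivAt_star_propagator hH t).mul_const O).mul (hasDerivAt_propagator H t)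
  refine h1.congr_deriv ?_
  have hc : Commute (star (propagator H t)) H := by
    rw [star_propagator hH]
    exact ((Commute.refl H).propagator_right _).symm
  have hc' : Commute H (propagator H t) := (Commute.refl H).propagator_right _
  rw [(hc.smul_right Complex.I).eq, (hc'.smul_left (-Complex.I)).eq]
  simp only [Ring.lie_def, heisenberg, smul_sub, mul_assoc, smul_mul_assoc,
    mul_neg, mul_smul_comm, neg_smul]
  rw [sub_eq_add_neg]

lemma lie_eq_zero_of_commute {x y : A} (h : Commute x y) : ⁅x, y⁆ = 0 := by
  rw [Ring.lie_def, h.eq, sub_self]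

lemma finset_sum_lie {ι : Type*} (s : Finset ι) (f : ι → A) (y : A) :
    ⁅∑ i ∈ s, f i, y⁆ = ∑ i ∈ s, ⁅f i, y⁆ := by
  simp only [Ring.lie_def, Finset.sum_mul, Finset.mul_sum, Finset.sum_sub_distrib]

lemma norm_lie_le (x y : A) : ‖⁅x, y⁆‖ ≤ 2 * ‖x‖ * ‖y‖ := by
  rw [Ring.lie_def]
  have h1 := norm_mul_le x y
  have h2 := norm_mul_le y x
  have h3 := norm_sub_le (x * y) (y * x)
  linarith [mul_comm ‖x‖ ‖y‖]

lemma star_mul_lie_mul {U : A} (hU : U ∈ unitary A) (x y : A) :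
    star U * ⁅x, y⁆ * U = ⁅star U * x * U, star U * y * U⁆ := by
  have h := Unitary.mul_star_self_of_mem hU
  have key : ∀ a b : A, star U * (a * b) * U = star U * a * U * (star U * b * U) := fun a b => by
    calc star U * (a * b) * U = star U * a * 1 * b * U := by simp only [mul_one, mul_assoc]
      _ = _ := by rw [← h]; simp only [mul_assoc]
  rw [Ring.lie_def, Ring.lie_def, mul_sub, sub_mul, key, key]

lemma norm_lie_conj {U : A} (hU : U ∈ unitary A) (x y : A) :
    ‖⁅star U * x * U, star U * y * U⁆‖ = ‖⁅x, y⁆‖ := by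
  rw [← star_mul_lie_mul hU, norm_star_mul_mul_of_mem_unitary hU]

/-- Passing to an interaction picture, the commutator of a Heisenberg-evolved observable `O` with
`B` only feels the part `K` of the Hamiltonian which does not commute with `O`. -/
lemma exists_interactionPicture {H K O : A} (hH : IsSelfAdjoint H) (hK : IsSelfAdjoint K)
    (hO : Commute O (H - K)) (B : A) :
    ∃ G G' : ℝ → A, (∀ t, HasDerivAt G (G' t) t) ∧ (∀ t, ‖G t‖ = ‖⁅heisenberg H t O, B⁆‖) ∧
      ∀ t, ‖G' t‖ ≤ 2 * ‖O‖ * ‖⁅heisenberg H t K, B⁆‖ := by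
  have hHK : IsSelfAdjoint (H - K) := hH.sub hK
  -- `B` is evolved backwards by `H` and then forwards by `H - K`, so that only `K` survives in the
  -- derivative. As `O` is invariant under `H - K`, the commutator of `O` with `C t` has the norm of
  -- that of the evolved `O` with `B`.
  set C : ℝ → A := fun t => heisenberg (H - K) t
    (propagator H t * B * star (propagator H t)) with hC
  set C' : ℝ → A := fun t => star (propagator (H - K) t)
      * ((-Complex.I) • ⁅K, propagator H t * B * star (propagator H t)⁆)
      * propagator (H - K) t with hC'
  have hderiv : ∀ t, HasDerivAt C (C' t) t := by
    intro t
    have hU := propagator_mem_unitary hH t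
    have h0 : HasDerivAt (fun t => propagator H t * B * star (propagator H t))
        ((-Complex.I) • ⁅H, propagator H t * B * star (propagator H t)⁆) t := by
      refine (((hasDerivAt_propagator H t).mul_const B).mul
        (hasDerivAt_star_propagator hH t)).congr_deriv ?_
      simp only [Ring.lie_def, smul_sub, mul_smul_comm, smul_mul_assoc, neg_smul, mul_assoc,
        neg_mul]
      abel
    have h1 := ((hasDerivAt_star_propagator hHK t).mul h0).mul (hasDerivAt_propagator (H - K) t)
    refine h1.congr_deriv ?_
    simp only [hC', Ring.lie_def, Pi.mul_apply]
    generalize propagator H t * B * star (propagator H t) = X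
    generalize star (propagator (H - K) t) = V
    have hc' : Commute (H - K) (propagator (H - K) t) := (Commute.refl _).propagator_right _
    generalize propagator (H - K) t = V' at hc' ⊢
    simp only [smul_sub, mul_sub, sub_mul, mul_smul_comm, smul_mul_assoc, neg_smul, mul_assoc,
      add_mul, neg_mul, mul_neg]
    abel
  refine ⟨fun t => ⁅O, C t⁆, fun t => ⁅O, C' t⁆, fun t => ?_, fun t => ?_, fun t => ?_⟩
  · simp only [Ring.lie_def]
    exact ((hderiv t).const_mul O).sub ((hderiv t).mul_const O)
  · have hU := propagator_mem_unitary hH t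
    have hV := propagator_mem_unitary hHK t
    have hO' : O = star (propagator (H - K) t) * O * propagator (H - K) t := by
      rw [mul_assoc, (hO.propagator_right t).eq, ← mul_assoc, star_propagator_mul_self hHK,
        one_mul]
    have h1 : ⁅O, C t⁆ = star (propagator (H - K) t)
        * ⁅O, propagator H t * B * star (propagator H t)⁆ * propagator (H - K) t := by
      rw [star_mul_lie_mul hV, ← hO']
      rfl
    change ‖⁅O, C t⁆‖ = _
    rw [h1, norm_star_mul_mul_of_mem_unitary hV, ← norm_lie_conj hU]
    congr 2
    calc _ = (star (propagator H t) * propagator H t) * B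
          * (star (propagator H t) * propagator H t) := by simp only [mul_assoc]
      _ = B := by rw [star_propagator_mul_self hH]; simp
  · have hU := propagator_mem_unitary hH t
    have hV := propagator_mem_unitary hHK t
    refine (norm_lie_le _ _).trans (le_of_eq ?_)
    congr 1
    rw [hC', norm_star_mul_mul_of_mem_unitary hV, norm_smul, ← norm_lie_conj hU]
    simp only [norm_neg, Complex.norm_I, one_mul]
    congr 2
    calc _ = (star (propagator H t) * propagator H t) * B
          * (star (propagator H t) * propagator H t) := by simp only [mul_assoc]
      _ = B := by rw [star_propagator_mul_self hH]; simp

variable {ι : Type*} [Fintype ι] {h : ι → A} {adj : ι → ι → Prop}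

open Classical in
/-- Lieb–Robinson bound for the commutator of an evolved term with `B`, in terms of a function `D`
on the terms that is `1`-Lipschitz for the interaction graph. -/
lemma liebRobinson_term (hh : ∀ α, IsSelfAdjoint (h α))
    (hadj : ∀ α β, ¬ adj α β → Commute (h α) (h β))
    {J m : ℝ} {Z : ℕ} (hJ0 : 0 ≤ J) (hJ : ∀ α, ‖h α‖ ≤ J)
    (hZ : ∀ β, (Finset.univ.filter fun γ => adj γ β).card ≤ Z) {D : ι → ℝ}
    (hD : ∀ γ β, adj γ β → D β ≤ D γ + 1) {B : A}
    (hB : ∀ β, ¬ Commute (h β) B → D β ≤ m) {t : ℝ} (ht : 0 ≤ t) (β : ι) :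
    ‖⁅heisenberg (∑ α, h α) t (h β), B⁆‖
      ≤ 2 * J * ‖B‖ * Real.exp (m - D β) * Real.exp (2 * Real.exp 1 * J * Z * t) := by
  have hH : IsSelfAdjoint (∑ α, h α) := isSelfAdjoint_finset_sum hh
  have hK : ∀ β, IsSelfAdjoint (∑ γ with adj γ β, h γ) := fun β => isSelfAdjoint_finset_sum hh
  have hc : ∀ β, Commute (h β) (∑ α, h α - ∑ γ with adj γ β, h γ) := by
    intro β
    rw [← Finset.sum_filter_add_sum_filter_not Finset.univ (fun γ => adj γ β),
      add_sub_cancel_left]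
    exact Commute.sum_right _ _ _ fun γ hγ => (hadj γ β (Finset.mem_filter.1 hγ).2).symm
  choose G G' hG hGn hG' using fun β => exists_interactionPicture hH (hK β) (hc β) B
  have hderiv : ∀ s, HasDerivAt (fun s β => Real.exp (D β) • G β s)
      (fun β => Real.exp (D β) • G' β s) s := fun s =>
    hasDerivAt_pi.2 fun β => (hG β s).const_smul _
  -- Grönwall for all terms at once, in the sup norm weighted by `exp (D β)`. At time `0` only terms
  -- with `D β ≤ m` contribute; the rate has a factor `Z` from the neighbours and a factor `e` from
  -- changing the weight by one unit of `D`.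
  have hmain := norm_le_gronwallBound_of_norm_deriv_right_le
    (f := fun s β => Real.exp (D β) • G β s) (f' := fun s β => Real.exp (D β) • G' β s)
    (δ := Real.exp m * (2 * J * ‖B‖)) (K := 2 * Real.exp 1 * J * Z) (ε := 0) (a := 0) (b := t)
    (fun s _ => (hderiv s).continuousAt.continuousWithinAt)
    (fun s _ => (hderiv s).hasDerivWithinAt) ?_ ?_ t (Set.right_mem_Icc.2 ht)
  · rw [gronwallBound_ε0, sub_zero] at hmain
    have h1 := (norm_le_pi_norm (fun β => Real.exp (D β) • G β t) β).trans hmain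
    rw [norm_smul, Real.norm_eq_abs, abs_of_pos (Real.exp_pos _), hGn] at h1
    rw [Real.exp_sub]
    have h2 : ‖⁅heisenberg (∑ α, h α) t (h β), B⁆‖ ≤
        (Real.exp m * (2 * J * ‖B‖) * Real.exp (2 * Real.exp 1 * J * Z * t)) / Real.exp (D β) := by
      rw [le_div_iff₀ (Real.exp_pos _)]
      linarith
    refine h2.trans (le_of_eq ?_)
    ring
  · refine (pi_norm_le_iff_of_nonneg (by positivity)).2 fun β => ?_
    rw [norm_smul, Real.norm_eq_abs, abs_of_pos (Real.exp_pos _), hGn, heisenberg_zero]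
    by_cases hcomm : Commute (h β) B
    · rw [lie_eq_zero_of_commute hcomm, norm_zero, mul_zero]
      positivity
    · have := hB β hcomm
      have h1 := (norm_lie_le (h β) B).trans
        (mul_le_mul_of_nonneg_right (mul_le_mul_of_nonneg_left (hJ β) zero_le_two)
          (norm_nonneg B))
      gcongr
  · intro s _
    rw [add_zero]
    refine (pi_norm_le_iff_of_nonneg (by positivity)).2 fun β => ?_
    set N := ‖fun β => Real.exp (D β) • G β s‖ with hN
    rw [norm_smul, Real.norm_eq_abs, abs_of_pos (Real.exp_pos _)]
    have h1 : ∀ γ ∈ Finset.univ.filter (fun γ => adj γ β),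
        Real.exp (D β) * ‖⁅heisenberg (∑ α, h α) s (h γ), B⁆‖ ≤ Real.exp 1 * N := by
      intro γ hγ
      have h2 := norm_le_pi_norm (fun β => Real.exp (D β) • G β s) γ
      rw [norm_smul, Real.norm_eq_abs, abs_of_pos (Real.exp_pos _), hGn, ← hN] at h2
      have h3 : Real.exp (D β) ≤ Real.exp 1 * Real.exp (D γ) := by
        rw [← Real.exp_add]
        exact Real.exp_le_exp.2 (by linarith [hD γ β (Finset.mem_filter.1 hγ).2])
      calc _ ≤ Real.exp 1 * Real.exp (D γ) * ‖⁅heisenberg (∑ α, h α) s (h γ), B⁆‖ := by gcongr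
        _ = Real.exp 1 * (Real.exp (D γ) * ‖⁅heisenberg (∑ α, h α) s (h γ), B⁆‖) := by ring
        _ ≤ _ := by gcongr
    have h4 : Real.exp (D β) * ‖⁅heisenberg (∑ α, h α) s (∑ γ with adj γ β, h γ), B⁆‖
        ≤ Z * (Real.exp 1 * N) := by
      rw [heisenberg_sum, finset_sum_lie]
      calc _ ≤ Real.exp (D β) * ∑ γ with adj γ β, ‖⁅heisenberg (∑ α, h α) s (h γ), B⁆‖ := by
            gcongr
            exact norm_sum_le _ _
        _ ≤ ∑ γ with adj γ β, Real.exp 1 * N := by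
            rw [Finset.mul_sum]
            exact Finset.sum_le_sum h1
        _ ≤ _ := by
            rw [Finset.sum_const, nsmul_eq_mul]
            have := hZ β
            gcongr
    calc Real.exp (D β) * ‖G' β s‖
        ≤ Real.exp (D β) * (2 * ‖h β‖
          * ‖⁅heisenberg (∑ α, h α) s (∑ γ with adj γ β, h γ), B⁆‖) := by
          gcongr; exact hG' β s
      _ ≤ Real.exp (D β) * (2 * J
          * ‖⁅heisenberg (∑ α, h α) s (∑ γ with adj γ β, h γ), B⁆‖) := by
          gcongr; exact hJ β
      _ = 2 * J * (Real.exp (D β)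
          * ‖⁅heisenberg (∑ α, h α) s (∑ γ with adj γ β, h γ), B⁆‖) := by ring
      _ ≤ 2 * J * (Z * (Real.exp 1 * N)) := by gcongr
      _ = _ := by ring

open Classical in
/-- Lieb–Robinson bound for an observable `O` that commutes with the terms outside `S`. -/
lemma liebRobinson (hh : ∀ α, IsSelfAdjoint (h α)) (hadj : ∀ α β, ¬ adj α β → Commute (h α) (h β))
    {J m d₀ n : ℝ} {Z : ℕ} (hJ0 : 0 ≤ J) (hJ : ∀ α, ‖h α‖ ≤ J)
    (hZ : ∀ β, (Finset.univ.filter fun γ => adj γ β).card ≤ Z) {D : ι → ℝ}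
    (hD : ∀ γ β, adj γ β → D β ≤ D γ + 1) {B O : A}
    (hB : ∀ β, ¬ Commute (h β) B → D β ≤ m) {S : Finset ι} (hn : 1 ≤ n)
    (hS : (S.card : ℝ) ≤ n * Z) (hSD : ∀ β ∈ S, d₀ ≤ D β)
    (hO : ∀ β ∉ S, Commute O (h β)) (hOB : ¬ Commute O B → d₀ ≤ m) {t : ℝ} (ht : 0 ≤ t) :
    ‖⁅heisenberg (∑ α, h α) t O, B⁆‖
      ≤ 2 * ‖O‖ * ‖B‖ * n * Real.exp (m - d₀) * Real.exp (4 * Real.exp 1 * J * Z * t) := by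
  have hH : IsSelfAdjoint (∑ α, h α) := isSelfAdjoint_finset_sum hh
  have hc : Commute O (∑ α, h α - ∑ γ ∈ S, h γ) := by
    rw [← Finset.sum_sdiff (Finset.subset_univ S), add_sub_cancel_right]
    exact Commute.sum_right _ _ _ fun γ hγ => hO γ (Finset.mem_sdiff.1 hγ).2
  obtain ⟨G, G', hG, hGn, hG'⟩ := exists_interactionPicture hH
    (isSelfAdjoint_finset_sum (s := S) hh) hc B
  set E := Real.exp (2 * Real.exp 1 * J * Z * t) with hE
  have hE1 : 1 ≤ E := Real.one_le_exp (by positivity)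
  have hbound : ∀ s ∈ Set.Ico 0 t, ‖G' s‖
      ≤ 2 * ‖O‖ * (n * Z * (2 * J * ‖B‖ * Real.exp (m - d₀) * E)) := by
    intro s hs
    refine (hG' s).trans ?_
    gcongr
    rw [heisenberg_sum, finset_sum_lie]
    refine (norm_sum_le _ _).trans ?_
    refine (Finset.sum_le_card_nsmul S _ (2 * J * ‖B‖ * Real.exp (m - d₀) * E)
      fun β hβ => ?_).trans ?_
    · refine (liebRobinson_term hh hadj hJ0 hJ hZ hD hB hs.1 β).trans ?_
      have := hSD β hβ
      have := hs.2.le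
      rw [hE]
      gcongr
    · rw [nsmul_eq_mul]
      gcongr
  have h1 := norm_image_sub_le_of_norm_deriv_le_segment'
    (fun s _ => (hG s).hasDerivWithinAt) hbound t (Set.right_mem_Icc.2 ht)
  have h2 : ‖G 0‖ ≤ 2 * ‖O‖ * ‖B‖ * Real.exp (m - d₀) := by
    rw [hGn, heisenberg_zero]
    by_cases hcomm : Commute O B
    · rw [lie_eq_zero_of_commute hcomm, norm_zero]
      positivity
    · have h3 : 1 ≤ Real.exp (m - d₀) := Real.one_le_exp (by linarith [hOB hcomm])
      refine (norm_lie_le O B).trans ?_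
      exact le_mul_of_one_le_right (by positivity) h3
  have h3 : ‖G t‖ ≤ ‖G 0‖ + ‖G t - G 0‖ := by
    simpa using norm_add_le (G 0) (G t - G 0)
  -- The linear growth from integrating over time is absorbed into a second copy of `E`; this turns
  -- the rate `2 e J Z` into `4 e J Z`.
  have h4 : 1 + 2 * J * Z * t ≤ E := by
    have h5 := Real.add_one_le_exp (2 * J * Z * t)
    have h6 : 2 * J * Z * t ≤ 2 * Real.exp 1 * J * Z * t := by
      have h7 : (1 : ℝ) ≤ Real.exp 1 := Real.one_le_exp zero_le_one
      have h8 : 0 ≤ 2 * J * Z * t := by positivity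
      nlinarith
    have := Real.exp_le_exp.2 h6
    linarith
  have hEE : Real.exp (4 * Real.exp 1 * J * Z * t) = E * E := by
    rw [hE, ← Real.exp_add]
    ring_nf
  rw [← hGn, hEE]
  have hP : 0 ≤ 2 * ‖O‖ * ‖B‖ * Real.exp (m - d₀) := by positivity
  set P := 2 * ‖O‖ * ‖B‖ * Real.exp (m - d₀) with hPdef
  calc ‖G t‖ ≤ P + 2 * ‖O‖ * (n * Z * (2 * J * ‖B‖ * Real.exp (m - d₀) * E)) * (t - 0) := by
        linarith
    _ = P + P * n * E * (2 * J * Z * t) := by rw [hPdef]; ring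
    _ ≤ P * n * E + P * n * E * (2 * J * Z * t) := by
        gcongr
        have : 1 ≤ n * E := one_le_mul_of_one_le_of_one_le hn hE1
        rw [mul_assoc]
        exact le_mul_of_one_le_right hP this
    _ = P * n * E * (1 + 2 * J * Z * t) := by ring
    _ ≤ P * n * E * E := by gcongr
    _ = _ := by rw [hPdef]; ring

end LiebRobinson

/-! ### From the generator to the error of a product formula -/

section StepError

variable {A κ : Type*} [CStarAlgebra A]

lemma hasDerivAt_star_productFormula {H : κ → A} (hH : ∀ r, IsSelfAdjoint (H r))
    (L : List (κ × ℝ)) (t : ℝ) :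
    HasDerivAt (fun t => star (productFormula H L t))
      (star (productFormula H L t) * (Complex.I • productGenerator H L t)) t := by
  refine (hasDerivAt_productFormula hH L t).star.congr_deriv ?_
  rw [star_smul, star_mul, (productGenerator_isSelfAdjoint hH L t).star_eq]
  simp

lemma productFormula_zero (H : κ → A) (L : List (κ × ℝ)) : productFormula H L 0 = 1 := by
  induction L with
  | nil => rfl
  | cons y L ih => rw [productFormula, ih, mul_zero, propagator_zero, mul_one]

/-- Duhamel's principle: `Φ t` uses the product formula for time `t` and the exact evolution for the
rest, and its derivative is a unitary conjugate of the commutator with `F - H₀`. -/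
lemma norm_productFormula_conj_sub_le {H : κ → A} (hH : ∀ r, IsSelfAdjoint (H r)) {H₀ : A}
    (hH₀ : IsSelfAdjoint H₀) (L : List (κ × ℝ)) {O : A} {τ ε b s : ℝ} (hs : 0 ≤ s) (hε : 0 ≤ ε)
    (hsε : s + ε ≤ τ)
    (hb : ∀ u, 0 ≤ u → u ≤ ε → ∀ v, 0 ≤ v → v ≤ τ →
      ‖⁅heisenberg H₀ v O, productGenerator H L u - H₀⁆‖ ≤ b) :
    ‖star (productFormula H L ε) * heisenberg H₀ s O * productFormula H L ε
      - heisenberg H₀ (s + ε) O‖ ≤ ε * b := by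
  set Φ : ℝ → A := fun t =>
    star (productFormula H L t) * heisenberg H₀ (s + ε - t) O * productFormula H L t with hΦ
  set Φ' : ℝ → A := fun t => star (productFormula H L t)
    * ((-Complex.I) • ⁅heisenberg H₀ (s + ε - t) O, productGenerator H L t - H₀⁆)
    * productFormula H L t with hΦ'
  have hd : ∀ t, HasDerivAt Φ (Φ' t) t := by
    intro t
    have h1 : HasDerivAt (fun t => heisenberg H₀ (s + ε - t) O)
        (-(Complex.I • ⁅H₀, heisenberg H₀ (s + ε - t) O⁆)) t := by
      have h2 := (hasDerivAt_heisenberg hH₀ O (s + ε - t)).scomp t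
        ((hasDerivAt_id t).const_sub (s + ε))
      exact h2.congr_deriv (by simp)
    have h3 := ((hasDerivAt_star_productFormula hH L t).mul h1).mul
      (hasDerivAt_productFormula hH L t)
    refine h3.congr_deriv ?_
    simp only [hΦ', Ring.lie_def, Pi.mul_apply]
    generalize heisenberg H₀ (s + ε - t) O = X
    generalize star (productFormula H L t) = V
    generalize productFormula H L t = V'
    simp only [smul_sub, mul_sub, sub_mul, mul_smul_comm, smul_mul_assoc, neg_smul, mul_assoc,
      add_mul, neg_mul, mul_neg]
    abel
  have hbound : ∀ t ∈ Set.Ico 0 ε, ‖Φ' t‖ ≤ b := by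
    intro t ht
    rw [hΦ', norm_star_mul_mul_of_mem_unitary (productFormula_mem_unitary hH L t), norm_smul]
    simp only [norm_neg, Complex.norm_I, one_mul]
    exact hb t ht.1 ht.2.le _ (by linarith [ht.2]) (by linarith [ht.1])
  have h1 := norm_image_sub_le_of_norm_deriv_le_segment'
    (fun t _ => (hd t).hasDerivWithinAt) hbound ε (Set.right_mem_Icc.2 hε)
  have h2 : Φ 0 = heisenberg H₀ (s + ε) O := by simp [hΦ, productFormula_zero]
  have h3 : Φ ε = star (productFormula H L ε) * heisenberg H₀ s O * productFormula H L ε := by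
    simp [hΦ]
  rw [h2, h3, sub_zero] at h1
  linarith

/-- Telescoping: the innermost Trotter step is exchanged for exact evolution, and the outer ones
preserve the norm of the error. The start time `s` is general because it advances by `ε` in the
induction. -/
lemma norm_productFormula_pow_conj_sub_le {H : κ → A} (hH : ∀ r, IsSelfAdjoint (H r)) {H₀ : A}
    (hH₀ : IsSelfAdjoint H₀) (L : List (κ × ℝ)) {O : A} {τ ε b : ℝ} (hε : 0 ≤ ε)
    (hb : ∀ u, 0 ≤ u → u ≤ ε → ∀ v, 0 ≤ v → v ≤ τ →
      ‖⁅heisenberg H₀ v O, productGenerator H L u - H₀⁆‖ ≤ b) (n : ℕ) {s : ℝ} (hs : 0 ≤ s)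
    (hsn : s + n * ε ≤ τ) :
    ‖star (productFormula H L ε ^ n) * heisenberg H₀ s O * productFormula H L ε ^ n
      - heisenberg H₀ (s + n * ε) O‖ ≤ n * ε * b := by
  induction n generalizing s with
  | zero => simp
  | succ n ih =>
    push_cast at hsn ⊢
    have hn : (0 : ℝ) ≤ n * ε := by positivity
    have h1 := norm_productFormula_conj_sub_le hH hH₀ L hs hε (by linarith) hb
    have h2 := ih (s := s + ε) (by linarith) (by linarith)
    have hU := pow_mem (productFormula_mem_unitary hH L ε) n
    rw [← norm_star_mul_mul_of_mem_unitary hU] at h1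
    have h3 := norm_add_le_of_le h1 h2
    rw [show s + (n + 1) * ε = s + ε + n * ε by ring]
    refine le_trans (le_of_eq ?_) (h3.trans (le_of_eq (by ring)))
    congr 1
    rw [pow_succ', star_mul, mul_sub, sub_mul]
    simp only [mul_assoc]
    abel

end StepError

/-! ### Supports of operators -/

section Support

variable {d : ℕ} {Λ : Finset (Fin d → ℤ)} {q : Λ → ℕ}

lemma IsSupportedOn.apply_eq_zero {O : SpinOp Λ q} {X : Finset Λ} (hO : IsSupportedOn O X)
    {σ σ' : SpinConfig Λ q} {s : Λ} (hs : s ∉ X) (hne : σ s ≠ σ' s) : O σ σ' = 0 := by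
  obtain ⟨A, hA⟩ := hO
  rw [hA, if_neg fun h => hne (h s hs)]

lemma IsSupportedOn.apply_congr {O : SpinOp Λ q} {X : Finset Λ} (hO : IsSupportedOn O X)
    {σ σ' η η' : SpinConfig Λ q} (hσ : ∀ s ∉ X, σ s = σ' s) (hη : ∀ s ∉ X, η s = η' s)
    (h : ∀ s ∈ X, σ s = η s) (h' : ∀ s ∈ X, σ' s = η' s) : O σ σ' = O η η' := by
  obtain ⟨A, hA⟩ := hO
  rw [hA, hA, if_pos hσ, if_pos hη]
  congr 1
  · funext s; exact h s s.2
  · funext s; exact h' s s.2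

lemma isSupportedOn_univ (O : SpinOp Λ q) : IsSupportedOn O Finset.univ :=
  ⟨fun a b => O (fun s => a ⟨s, Finset.mem_univ s⟩) (fun s => b ⟨s, Finset.mem_univ s⟩),
    fun σ σ' => by simp⟩

/-- The matrix elements of a product of operators with disjoint supports. -/
lemma IsSupportedOn.mul_apply {O O' : SpinOp Λ q} {X X' : Finset Λ} (hO : IsSupportedOn O X)
    (hO' : IsSupportedOn O' X') (hd : Disjoint X X') (σ τ : SpinConfig Λ q) :
    (O * O') σ τ = O σ (fun s => if s ∈ X then τ s else σ s)
      * O' (fun s => if s ∈ X then τ s else σ s) τ := by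
  rw [Matrix.mul_apply]
  -- A contributing intermediate configuration must agree with `σ` off `X`, and with `τ` off `X'`,
  -- in particular on `X`.
  refine Finset.sum_eq_single _ (fun μ _ hμ => ?_) (fun h => absurd (Finset.mem_univ _) h)
  obtain ⟨s, hs⟩ := Function.ne_iff.1 hμ
  by_cases hsX : s ∈ X
  · rw [if_pos hsX] at hs
    rw [hO'.apply_eq_zero (Finset.disjoint_left.1 hd hsX) hs, mul_zero]
  · rw [if_neg hsX] at hs
    rw [hO.apply_eq_zero hsX (Ne.symm hs), zero_mul]

lemma IsSupportedOn.commute {O O' : SpinOp Λ q} {X X' : Finset Λ} (hO : IsSupportedOn O X)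
    (hO' : IsSupportedOn O' X') (hd : Disjoint X X') : Commute O O' := by
  ext σ τ
  rw [hO.mul_apply hO' hd, hO'.mul_apply hO hd.symm]
  -- Both products vanish if `σ` and `τ` differ at a site outside both supports; otherwise they
  -- consist of the same two matrix elements.
  by_cases h : ∀ s, s ∉ X → s ∉ X' → σ s = τ s
  · rw [mul_comm]
    congr 1
    · refine hO'.apply_congr ?_ ?_ ?_ ?_
      · intro s hs
        by_cases hsX : s ∈ X
        · simp [hsX]
        · simpa [hsX] using h s hsX hs
      · intro s hs; simp [hs]
      · intro s hs; simp [Finset.disjoint_right.1 hd hs]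
      · intro s hs; simp [hs]
    · refine hO.apply_congr ?_ ?_ ?_ ?_
      · intro s hs; simp [hs]
      · intro s hs
        by_cases hsX : s ∈ X'
        · simp [hsX]
        · simpa [hsX] using h s hs hsX
      · intro s hs; simp [Finset.disjoint_left.1 hd hs]
      · intro s hs; simp [hs]
  · push Not at h
    obtain ⟨s, hs, hs', hne⟩ := h
    have h1 := hO'.apply_eq_zero (σ := fun s => if s ∈ X then τ s else σ s) (σ' := τ) hs'
      (by simp only [if_neg hs]; exact hne)
    have h2 := hO.apply_eq_zero (σ := fun s => if s ∈ X' then τ s else σ s) (σ' := τ) hs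
      (by simp only [if_neg hs']; exact hne)
    exact (mul_eq_zero_of_right _ h1).trans (mul_eq_zero_of_right _ h2).symm

open Classical in
-- `opSupport` tests one site at a time. Joint support follows by overwriting the sites outside `X`
-- one by one with a reference configuration, which leaves the matrix element unchanged.
lemma isSupportedOn_of_opSupport_subset {O : SpinOp Λ q} {X : Finset Λ}
    (hX : ∀ s ∈ opSupport O, s ∈ X) : IsSupportedOn O X := by
  have herase : ∀ s ∉ X, IsSupportedOn O (Finset.univ.erase s) := fun s hs => by
    by_contra h
    exact hs (hX s h)
  -- A local dimension may be `0`, and then there is no reference configuration.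
  rcases isEmpty_or_nonempty (SpinConfig Λ q) with hemp | ⟨⟨σ₀⟩⟩
  · exact ⟨0, fun σ => (hemp.false σ).elim⟩
  refine ⟨fun a b => O (fun s => if hs : s ∈ X then a ⟨s, hs⟩ else σ₀ s)
    (fun s => if hs : s ∈ X then b ⟨s, hs⟩ else σ₀ s), fun σ σ' => ?_⟩
  split_ifs with h
  · have key : ∀ Y : Finset Λ, Disjoint Y X →
        O σ σ' = O (fun s => if s ∈ Y then σ₀ s else σ s)
          (fun s => if s ∈ Y then σ₀ s else σ' s) := by
      intro Y
      induction Y using Finset.induction_on with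
      | empty => intro _; simp
      | insert s Y _ ih =>
        intro hY
        rw [Finset.disjoint_insert_left] at hY
        rw [ih hY.2]
        refine (herase s hY.1).apply_congr ?_ ?_ ?_ ?_
        · intro u hu
          obtain rfl : u = s := by simpa using hu
          simp [h u hY.1]
        · intro u hu
          obtain rfl : u = s := by simpa using hu
          simp
        · intro u hu
          have : u ≠ s := by simpa using hu
          simp [this]
        · intro u hu
          have : u ≠ s := by simpa using hu
          simp [this]
    rw [key Xᶜ disjoint_compl_left]
    congr 1
    · funext s
      by_cases hs : s ∈ X <;> simp [hs]
    · funext s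
      by_cases hs : s ∈ X <;> simp [hs]
  · push Not at h
    obtain ⟨s, hs, hne⟩ := h
    exact (herase s hs).apply_eq_zero (by simp) hne

open Classical in
lemma commute_of_opSupport_disjoint {O O' : SpinOp Λ q} {X : Finset Λ}
    (hO' : IsSupportedOn O' X) (hd : ∀ s ∈ opSupport O, s ∉ X) : Commute O O' := by
  have hO : IsSupportedOn O Xᶜ :=
    isSupportedOn_of_opSupport_subset fun s hs => Finset.mem_compl.2 (hd s hs)
  exact hO.commute hO' disjoint_compl_left

open Classical in
lemma commute_of_opSupport_inter_empty {O O' : SpinOp Λ q}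
    (hd : ¬ (opSupport O ∩ opSupport O').Nonempty) : Commute O O' := by
  refine commute_of_opSupport_disjoint
    (isSupportedOn_of_opSupport_subset (X := {s | s ∈ opSupport O'}) fun s hs => by simpa using hs)
    fun s hs hs' => hd ⟨s, hs, by simpa using hs'⟩

lemma commute_of_opSupport_empty {O : SpinOp Λ q} (hO : ¬ (opSupport O).Nonempty)
    (O' : SpinOp Λ q) : Commute O O' :=
  commute_of_opSupport_inter_empty fun ⟨s, hs, _⟩ => hO ⟨s, hs⟩

end Support

/-! ### Expectation values -/

section Trace

variable {n : Type*} [Fintype n] [DecidableEq n]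

/-- Write `ρ = B⋆ B`. The trace is `∑ ⟨b i, Y b i⟩` over the conjugated rows `b i` of `B`, and `∑ ‖b
i‖² = Tr ρ = 1`. -/
lemma norm_trace_mul_le {Y ρ : Matrix n n ℂ} (hρ : ρ.PosSemidef) (hρ' : ρ.trace = 1) :
    ‖(Y * ρ).trace‖ ≤ ‖Y‖ := by
  obtain ⟨B, rfl⟩ := (by open scoped MatrixOrder in
    exact CStarAlgebra.nonneg_iff_eq_star_mul_self.1 hρ.nonneg :
      ∃ B : Matrix n n ℂ, ρ = star B * B)
  rw [Matrix.star_eq_conjTranspose] at hρ' ⊢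
  set b : n → EuclideanSpace ℂ n := fun i => WithLp.toLp 2 fun j => star (B i j) with hb
  have hb2 : ∀ i, ((‖b i‖ ^ 2 : ℝ) : ℂ) = ∑ j, B i j * star (B i j) := by
    intro i
    rw [EuclideanSpace.norm_sq_eq]
    push_cast
    refine Finset.sum_congr rfl fun j _ => ?_
    simp [hb, Complex.mul_conj, Complex.normSq_eq_norm_sq]
  have htr : ∑ i, ‖b i‖ ^ 2 = 1 := by
    have h1 : ((∑ i, ‖b i‖ ^ 2 : ℝ) : ℂ) = 1 := by
      rw [← hρ', Matrix.trace_mul_comm]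
      push_cast
      simp only [Matrix.trace, Matrix.diag, Matrix.mul_apply, Matrix.conjTranspose_apply]
      refine Finset.sum_congr rfl fun i _ => ?_
      rw [← hb2]
      push_cast
      rfl
    exact_mod_cast h1
  have hterm : ∀ i, ‖(B * (Y * B.conjTranspose)) i i‖ ≤ ‖Y‖ * ‖b i‖ ^ 2 := by
    intro i
    have h1 : (B * (Y * B.conjTranspose)) i i
        = inner ℂ (b i) (WithLp.toLp 2 (Y.mulVec (b i).ofLp)) := by
      rw [EuclideanSpace.inner_eq_star_dotProduct, Matrix.mul_apply]
      simp only [dotProduct, Matrix.mulVec, Matrix.mul_apply, Matrix.conjTranspose_apply, hb,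
        Pi.star_apply, star_star]
      refine Finset.sum_congr rfl fun j _ => ?_
      rw [mul_comm]
    rw [h1]
    refine (norm_inner_le_norm _ _).trans ?_
    have h2 := Matrix.l2_opNorm_mulVec Y (b i)
    calc ‖b i‖ * _ ≤ ‖b i‖ * (‖Y‖ * ‖b i‖) := by gcongr; exact h2
      _ = _ := by ring
  rw [← mul_assoc, Matrix.trace_mul_comm]
  calc ‖(B * (Y * B.conjTranspose)).trace‖ ≤ ∑ i, ‖(B * (Y * B.conjTranspose)) i i‖ :=
        norm_sum_le _ _
    _ ≤ ∑ i, ‖Y‖ * ‖b i‖ ^ 2 := Finset.sum_le_sum fun i _ => hterm i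
    _ = ‖Y‖ := by rw [← Finset.mul_sum, htr, mul_one]

end Trace

/-! ### Lattice sums -/

section Lattice

variable {d : ℕ}

lemma siteDist_self (x : Fin d → ℤ) : siteDist x x = 0 := by simp [siteDist]

lemma siteDist_comm (x y : Fin d → ℤ) : siteDist x y = siteDist y x := by
  refine Finset.sum_congr rfl fun i _ => ?_
  rw [← Int.natAbs_neg, neg_sub]

lemma siteDist_triangle (x y z : Fin d → ℤ) : siteDist x z ≤ siteDist x y + siteDist y z := by
  rw [siteDist, siteDist, siteDist, ← Finset.sum_add_distrib]
  refine Finset.sum_le_sum fun i _ => ?_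
  omega

lemma natAbs_le_siteDist (x y : Fin d → ℤ) (i : Fin d) : (x i - y i).natAbs ≤ siteDist x y :=
  Finset.single_le_sum (f := fun i => (x i - y i).natAbs) (fun _ _ => Nat.zero_le _)
    (Finset.mem_univ i)

lemma card_siteDist_le (S : Finset (Fin d → ℤ)) (y : Fin d → ℤ) (r : ℕ) :
    (S.filter fun x => siteDist x y ≤ r).card ≤ (2 * r + 1) ^ d := by
  have h1 : (S.filter fun x => siteDist x y ≤ r)
      ⊆ Fintype.piFinset fun i => Finset.Icc (y i - r) (y i + r) := by
    intro x hx
    rw [Fintype.mem_piFinset]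
    intro i
    have := (natAbs_le_siteDist x y i).trans (Finset.mem_filter.1 hx).2
    rw [Finset.mem_Icc]
    omega
  refine (Finset.card_le_card h1).trans ?_
  rw [Fintype.card_piFinset]
  simp only [Int.card_Icc]
  refine le_of_eq ?_
  rw [Finset.prod_congr rfl (g := fun _ => 2 * r + 1) (fun i _ => by omega)]
  simp

lemma sum_range_exp_neg_div_le {w : ℝ} (hw : 0 < w) (R : ℕ) :
    ∑ n ∈ Finset.range R, Real.exp (-((n : ℝ) + 1) / w) ≤ w := by
  set y := Real.exp (-1 / w) with hy
  have hy0 : 0 < y := Real.exp_pos _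
  have hyw : y * (1 + w) ≤ w := by
    have h1 := Real.add_one_le_exp (1 / w)
    have h2 : y * Real.exp (1 / w) = 1 := by
      rw [hy, ← Real.exp_add]
      rw [show -1 / w + 1 / w = 0 by ring, Real.exp_zero]
    have h3 : y * (1 / w + 1) ≤ 1 := (mul_le_mul_of_nonneg_left h1 hy0.le).trans h2.le
    have h4 : y * (1 + w) = y * (1 / w + 1) * w := by field_simp
    rw [h4]
    exact mul_le_of_le_one_left hw.le h3
  -- The term `y ^ R` makes the induction close. It works because `y / (1 - y) ≤ w`, a form of `exp
  -- (1 / w) ≥ 1 + 1 / w`.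
  have hS : ∀ R : ℕ, ∑ n ∈ Finset.range R, Real.exp (-((n : ℝ) + 1) / w)
      ≤ w * (1 - y ^ R) := by
    intro R
    induction R with
    | zero => simp
    | succ R ih =>
      rw [Finset.sum_range_succ]
      have h5 : Real.exp (-((R : ℝ) + 1) / w) = y * y ^ R := by
        rw [← pow_succ', hy, ← Real.exp_nat_mul]
        congr 1
        push_cast
        ring
      rw [h5, pow_succ']
      have h6 : 0 < y ^ R := by positivity
      nlinarith
  refine (hS R).trans ?_
  have : 0 < y ^ R := by positivity
  nlinarith

lemma sum_Icc_exp_neg_natAbs_div_le {w : ℝ} (hw : 1 ≤ w) (y : ℤ) (R : ℕ) :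
    ∑ x ∈ Finset.Icc (y - R) (y + R), Real.exp (-((x - y).natAbs : ℝ) / w) ≤ 3 * w := by
  have hw0 : 0 < w := by linarith
  have h : ∑ x ∈ Finset.Icc (y - R) (y + R), Real.exp (-((x - y).natAbs : ℝ) / w)
      ≤ 1 + 2 * ∑ n ∈ Finset.range R, Real.exp (-((n : ℝ) + 1) / w) := by
    have hsub : Finset.Icc (y - R) (y + R) ⊆ insert y
        ((Finset.range R).image (fun n : ℕ => y + ((n : ℤ) + 1))
          ∪ (Finset.range R).image (fun n : ℕ => y - ((n : ℤ) + 1))) := by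
      intro x hx
      rw [Finset.mem_Icc] at hx
      simp only [Finset.mem_insert, Finset.mem_union, Finset.mem_image, Finset.mem_range]
      rcases lt_trichotomy x y with h | h | h
      · exact Or.inr (Or.inr ⟨(y - x - 1).toNat, by omega, by omega⟩)
      · exact Or.inl h
      · exact Or.inr (Or.inl ⟨(x - y - 1).toNat, by omega, by omega⟩)
    have hpos : ∀ x : ℤ, 0 ≤ Real.exp (-((x - y).natAbs : ℝ) / w) := fun x =>
      (Real.exp_pos _).le
    have hp : ∑ x ∈ (Finset.range R).image (fun n : ℕ => y + ((n : ℤ) + 1)),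
        Real.exp (-((x - y).natAbs : ℝ) / w)
        = ∑ n ∈ Finset.range R, Real.exp (-((n : ℝ) + 1) / w) := by
      rw [Finset.sum_image (fun a _ b _ hab => by simpa using hab)]
      refine Finset.sum_congr rfl fun n _ => ?_
      rw [show (y + ((n : ℤ) + 1) - y).natAbs = n + 1 by omega]
      push_cast
      rfl
    have hm : ∑ x ∈ (Finset.range R).image (fun n : ℕ => y - ((n : ℤ) + 1)),
        Real.exp (-((x - y).natAbs : ℝ) / w)
        = ∑ n ∈ Finset.range R, Real.exp (-((n : ℝ) + 1) / w) := by
      rw [Finset.sum_image (fun a _ b _ hab => by simpa using hab)]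
      refine Finset.sum_congr rfl fun n _ => ?_
      rw [show (y - ((n : ℤ) + 1) - y).natAbs = n + 1 by omega]
      push_cast
      rfl
    refine (Finset.sum_le_sum_of_subset_of_nonneg hsub fun x _ _ => hpos x).trans ?_
    rw [Finset.sum_insert, Finset.sum_union, hp, hm]
    · simp only [sub_self, Int.natAbs_zero, Nat.cast_zero, neg_zero, zero_div, Real.exp_zero]
      linarith
    · rw [Finset.disjoint_left]
      simp only [Finset.mem_image, Finset.mem_range]
      rintro x ⟨n, _, rfl⟩ ⟨m, _, hm⟩
      omega
    · simp only [Finset.mem_union, Finset.mem_image, Finset.mem_range]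
      rintro (⟨n, _, hn⟩ | ⟨n, _, hn⟩) <;> omega
  have := sum_range_exp_neg_div_le hw0 R
  linarith

/-- For the Manhattan distance the exponential factors over the coordinates, so after enlarging `S`
to a cube the sum is a product of one-dimensional ones. -/
lemma sum_exp_neg_siteDist_div_le {w : ℝ} (hw : 1 ≤ w) (S : Finset (Fin d → ℤ))
    (y : Fin d → ℤ) :
    ∑ x ∈ S, Real.exp (-(siteDist x y : ℝ) / w) ≤ (3 * w) ^ d := by
  obtain ⟨R, hR⟩ : ∃ R : ℕ, ∀ x ∈ S, siteDist x y ≤ R :=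
    ⟨S.sup fun x => siteDist x y, fun x hx => Finset.le_sup (f := fun x => siteDist x y) hx⟩
  have hsub : S ⊆ Fintype.piFinset fun i => Finset.Icc (y i - R) (y i + R) := by
    intro x hx
    rw [Fintype.mem_piFinset]
    intro i
    have := (natAbs_le_siteDist x y i).trans (hR x hx)
    rw [Finset.mem_Icc]
    omega
  calc ∑ x ∈ S, Real.exp (-(siteDist x y : ℝ) / w)
      ≤ ∑ x ∈ Fintype.piFinset fun i => Finset.Icc (y i - R) (y i + R),
          Real.exp (-(siteDist x y : ℝ) / w) :=
        Finset.sum_le_sum_of_subset_of_nonneg hsub fun _ _ _ => (Real.exp_pos _).le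
    _ = ∑ x ∈ Fintype.piFinset fun i => Finset.Icc (y i - R) (y i + R),
          ∏ i, Real.exp (-((x i - y i).natAbs : ℝ) / w) := by
        refine Finset.sum_congr rfl fun x _ => ?_
        rw [← Real.exp_sum, siteDist]
        congr 1
        push_cast
        rw [← Finset.sum_neg_distrib, Finset.sum_div]
    _ = ∏ i, ∑ x ∈ Finset.Icc (y i - R) (y i + R), Real.exp (-((x - y i).natAbs : ℝ) / w) :=
        (Finset.prod_univ_sum (fun i => Finset.Icc (y i - (R : ℤ)) (y i + R))
          fun i x => Real.exp (-((x - y i).natAbs : ℝ) / w)).symm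
    _ ≤ ∏ _i : Fin d, 3 * w :=
        Finset.prod_le_prod (fun i _ => Finset.sum_nonneg fun _ _ => (Real.exp_pos _).le)
          fun i _ => sum_Icc_exp_neg_natAbs_div_le hw (y i) R
    _ = (3 * w) ^ d := by simp

end Lattice

/-! ### Commutators with the Taylor remainders of the generator -/

section RemainderCommutator

variable {A ι κ : Type*} [CStarAlgebra A] [Fintype ι] {h : ι → A} {adj : ι → ι → Prop}

lemma interactionBall_depth_le {D : ι → ℝ} (hD : ∀ γ β, adj γ β → D β ≤ D γ + 1) {α : ι}
    (hα : D α ≤ 0) (m : ℕ) : ∀ β ∈ interactionBall adj α m, D β ≤ m := by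
  classical
  induction m with
  | zero =>
    intro β hβ
    obtain rfl : β = α := by simpa [interactionBall] using hβ
    simpa using hα
  | succ m ih =>
    intro β hβ
    push_cast
    simp only [interactionBall, thicken, Finset.mem_filter, Finset.mem_univ, true_and] at hβ
    rcases hβ with hβ | ⟨γ, hγ, hadj⟩
    · linarith [ih β hβ]
    · linarith [ih γ hγ, hD γ β hadj]

open Classical in
-- Inside the ball the depth `D` is at most `m`. A term that fails to commute with `B` is a
-- neighbour of the ball, which explains `m + 1`.
lemma norm_lie_heisenberg_le_of_localTo (hh : ∀ α, IsSelfAdjoint (h α))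
    (hadj : ∀ α β, ¬ adj α β → Commute (h α) (h β))
    {J d₀ n : ℝ} {Z : ℕ} (hJ0 : 0 ≤ J) (hJ : ∀ α, ‖h α‖ ≤ J)
    (hZ : ∀ β, (Finset.univ.filter fun γ => adj γ β).card ≤ Z) {D : ι → ℝ}
    (hD : ∀ γ β, adj γ β → D β ≤ D γ + 1) {α : ι} (hα : D α ≤ 0) {m : ℕ} {B O : A}
    (hB : ∀ W, (∀ β ∈ interactionBall adj α m, Commute W (h β)) → Commute W B)
    {S : Finset ι} (hn : 1 ≤ n)
    (hS : (S.card : ℝ) ≤ n * Z) (hSD : ∀ β ∈ S, d₀ ≤ D β)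
    (hO : ∀ β ∉ S, Commute O (h β)) {t : ℝ} (ht : 0 ≤ t) :
    ‖⁅heisenberg (∑ α, h α) t O, B⁆‖ ≤ 2 * ‖O‖ * ‖B‖ * n * Real.exp (m + 1 - d₀)
      * Real.exp (4 * Real.exp 1 * J * Z * t) := by
  have hball := interactionBall_depth_le hD hα m
  refine liebRobinson hh hadj hJ0 hJ hZ hD (fun β hβ => ?_) hn hS hSD hO (fun hOB => ?_) ht
  · by_contra hlt
    refine hβ (hB (h β) fun γ hγ => (hadj γ β fun hc => hlt ?_).symm)
    linarith [hD γ β hc, hball γ hγ]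
  · by_contra hlt
    refine hOB (hB O fun β hβ => hO β fun hβS => hlt ?_)
    linarith [hSD β hβS, hball β hβ]

lemma heisenberg_eq_self {H O : A} (hH : IsSelfAdjoint H) (hc : Commute O H) (t : ℝ) :
    heisenberg H t O = O := by
  rw [heisenberg, mul_assoc, (hc.propagator_right t).eq, ← mul_assoc, star_propagator_mul_self hH,
    one_mul]

/-- Interpolation between the trivial bound and the Lieb–Robinson bound. -/
lemma le_mul_exp_of_le_of_le {f c k L a r : ℝ} (hc : 0 ≤ c) (hk : 1 ≤ k) (hL : 0 ≤ L) (ha : 0 < a)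
    (h1 : f ≤ c) (h2 : f ≤ c * k * Real.exp ((L - r) / a)) :
    f ≤ c * k * Real.exp 1 * Real.exp (-r / (L + a)) := by
  have hLa : 0 < L + a := by linarith
  have h3 : Real.exp 1 * Real.exp (-r / (L + a)) = Real.exp ((L + a - r) / (L + a)) := by
    rw [← Real.exp_add]
    congr 1
    field_simp
    ring
  rw [mul_assoc, h3]
  have hck : c ≤ c * k := le_mul_of_one_le_right hc hk
  have hck0 : 0 ≤ c * k := hc.trans hck
  -- Up to distance `L + a` the trivial bound suffices. Beyond it `(L - r) / a ≤ (L + a - r) / (L +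
  -- a)`: the decay length is stretched from `a` to `L + a` in exchange for losing the factor `exp
  -- (L / a)`.
  rcases le_total r (L + a) with hr | hr
  · refine (h1.trans hck).trans (le_mul_of_one_le_right hck0 (Real.one_le_exp ?_))
    exact div_nonneg (by linarith) hLa.le
  · refine h2.trans (mul_le_mul_of_nonneg_left (Real.exp_le_exp.2 ?_) hck0)
    rw [div_le_div_iff₀ ha hLa]
    nlinarith

end RemainderCommutator

/-! ### Geometrically local Hamiltonians -/

section Geometry

variable {d : ℕ} {Λ : Finset (Fin d → ℤ)} {q : Λ → ℕ} {ι : Type}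

/-- Two terms overlap if their supports intersect. -/
def Overlap (h : ι → SpinOp Λ q) (β γ : ι) : Prop :=
  (opSupport (h β) ∩ opSupport (h γ)).Nonempty

/-- The distance of the support of `h β` from the site `s`, in units of `a`. -/
noncomputable def supportDepth (h : ι → SpinOp Λ q) (a : ℕ) (s : Λ) (β : ι) : ℝ :=
  ((sInf {n | ∃ u ∈ opSupport (h β), siteDist u.1 s.1 = n} : ℕ) : ℝ) / a

variable {h : ι → SpinOp Λ q} {a Z : ℕ} {J : ℝ}

lemma supportDepth_le {s u : Λ} {β : ι} (hu : u ∈ opSupport (h β)) :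
    supportDepth h a s β ≤ (siteDist u.1 s.1 : ℝ) / a := by
  rw [supportDepth]
  gcongr
  exact Nat.sInf_le ⟨u, hu, rfl⟩

/-- Nonemptiness matters: for an empty support `sInf` has the default value `0`, which is not a
distance that is attained. -/
lemma exists_supportDepth_eq (s : Λ) {β : ι} (hβ : (opSupport (h β)).Nonempty) :
    ∃ u ∈ opSupport (h β), supportDepth h a s β = (siteDist u.1 s.1 : ℝ) / a := by
  obtain ⟨v, hv⟩ := hβ
  obtain ⟨u, hu, hus⟩ := Nat.sInf_mem
    (s := {n | ∃ u ∈ opSupport (h β), siteDist u.1 s.1 = n}) ⟨_, v, hv, rfl⟩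
  exact ⟨u, hu, by rw [supportDepth, hus]⟩

lemma siteDist_div_le {x y z : Fin d → ℤ} (ha : 1 ≤ a) (hxy : siteDist x y ≤ a) :
    (siteDist x z : ℝ) / a ≤ (siteDist y z : ℝ) / a + 1 := by
  have ha0 : (0 : ℝ) < a := by exact_mod_cast ha
  rw [div_add_one ha0.ne']
  gcongr
  have := siteDist_triangle x y z
  have h2 : siteDist x z ≤ siteDist y z + a := by omega
  exact_mod_cast h2

/-- Moving from a site of `h γ` to a shared site changes the distance by at most the diameter `a`.
This converts steps in the interaction graph into lattice distance. -/
lemma supportDepth_lipschitz (hloc : IsGeometricallyLocal a Z J h) (ha : 1 ≤ a)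
    (s : Λ) (γ β : ι) (hadj : Overlap h γ β) :
    supportDepth h a s β ≤ supportDepth h a s γ + 1 := by
  obtain ⟨w, hwγ, hwβ⟩ := hadj
  obtain ⟨u, hu, hus⟩ := exists_supportDepth_eq (a := a) s ⟨w, hwγ⟩
  rw [hus]
  exact (supportDepth_le hwβ).trans (siteDist_div_le ha (hloc.diam_le γ w hwγ u hu))

lemma supportDepth_nonpos {s : Λ} {α : ι} (hs : s ∈ opSupport (h α)) :
    supportDepth h a s α ≤ 0 := by
  simpa [siteDist_self] using supportDepth_le (a := a) (s := s) hs

variable [Fintype ι]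

open Classical in
lemma card_overlap_le (hloc : IsGeometricallyLocal a Z J h)
    (β : ι) : (Finset.univ.filter fun γ => Overlap h γ β).card ≤ Z := by
  have := hloc.coordination_le β
  rw [Set.ncard_eq_toFinset_card'] at this
  refine le_trans (Finset.card_le_card ?_) this
  intro γ hγ
  simp only [Finset.mem_filter, Finset.mem_univ, true_and] at hγ
  exact Set.mem_toFinset.2 hγ

open Classical in
-- The terms through a given site pairwise overlap, so they all lie in the neighbourhood of any one
-- of them.
lemma card_mem_opSupport_le (hloc : IsGeometricallyLocal a Z J h)
    (u : Λ) :
    (Finset.univ.filter fun β => u ∈ opSupport (h β)).card ≤ Z := by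
  rcases (Finset.univ.filter fun β => u ∈ opSupport (h β)).eq_empty_or_nonempty with he | ⟨β, hβ⟩
  · simp [he]
  · refine le_trans (Finset.card_le_card fun γ hγ => ?_) (card_overlap_le hloc β)
    simp only [Finset.mem_filter, Finset.mem_univ, true_and] at hβ hγ ⊢
    exact ⟨u, hγ, hβ⟩

lemma opSupport_nonempty_of_mem_interactionBall {α : ι} (hα : (opSupport (h α)).Nonempty)
    (m : ℕ) : ∀ β ∈ interactionBall (Overlap h) α m, (opSupport (h β)).Nonempty := by
  classical
  induction m with
  | zero =>
    intro β hβ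
    obtain rfl : β = α := by simpa [interactionBall] using hβ
    exact hα
  | succ m ih =>
    intro β hβ
    simp only [interactionBall, thicken, Finset.mem_filter, Finset.mem_univ, true_and] at hβ
    rcases hβ with hβ | ⟨γ, _, u, _, hu⟩
    · exact ih β hβ
    · exact ⟨u, hu⟩

/-- Every term of the ball contains a site within `m * a` of `s`, and each such site lies in at most
`Z` terms. -/
lemma card_interactionBall_le (hloc : IsGeometricallyLocal a Z J h) (ha : 1 ≤ a)
    {α : ι} (hα : (opSupport (h α)).Nonempty) (m : ℕ) :
    (interactionBall (Overlap h) α m).card ≤ (2 * (m * a) + 1) ^ d * Z := by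
  classical
  obtain ⟨s, hs⟩ := hα
  have hdepth := interactionBall_depth_le (supportDepth_lipschitz hloc ha s)
    (supportDepth_nonpos hs) m
  have hsub : interactionBall (Overlap h) α m ⊆
      (Finset.univ.filter fun u : Λ => siteDist u.1 s.1 ≤ m * a).biUnion
        fun u => Finset.univ.filter fun β => u ∈ opSupport (h β) := by
    intro β hβ
    obtain ⟨u, hu, hus⟩ := exists_supportDepth_eq (a := a) s
      (opSupport_nonempty_of_mem_interactionBall ⟨s, hs⟩ m β hβ)
    have h1 := hdepth β hβ
    rw [hus, div_le_iff₀ (by exact_mod_cast ha)] at h1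
    simp only [Finset.mem_biUnion, Finset.mem_filter, Finset.mem_univ, true_and]
    exact ⟨u, by exact_mod_cast h1, hu⟩
  refine (Finset.card_le_card hsub).trans ?_
  refine (Finset.card_biUnion_le_card_mul _ _ Z fun u _ => card_mem_opSupport_le hloc u).trans ?_
  refine Nat.mul_le_mul_right Z (le_trans ?_ (card_siteDist_le Λ s.1 (m * a)))
  refine Finset.card_le_card_of_injOn Subtype.val (fun u hu => ?_) Subtype.val_injective.injOn
  have hu' : siteDist u.1 s.1 ≤ m * a := by simpa using hu
  simpa using hu'

open Classical in
/-- Summing a decaying weight over the sites of the supports of all terms. -/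
lemma sum_sum_exp_neg_siteDist_le (hloc : IsGeometricallyLocal a Z J h)
    {w : ℝ} (hw : 1 ≤ w) (X : Finset Λ) :
    ∑ α, ∑ x ∈ X, ∑ s with s ∈ opSupport (h α), Real.exp (-(siteDist s.1 x.1 : ℝ) / w)
      ≤ X.card * Z * (3 * w) ^ d := by
  rw [Finset.sum_comm]
  have hx : ∀ x ∈ X, ∑ α, ∑ s with s ∈ opSupport (h α), Real.exp (-(siteDist s.1 x.1 : ℝ) / w)
      ≤ Z * (3 * w) ^ d := by
    intro x _
    simp only [Finset.sum_filter]
    rw [Finset.sum_comm]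
    calc ∑ s : Λ, ∑ α, (if s ∈ opSupport (h α) then Real.exp (-(siteDist s.1 x.1 : ℝ) / w) else 0)
        ≤ ∑ s : Λ, Z * Real.exp (-(siteDist s.1 x.1 : ℝ) / w) := by
          refine Finset.sum_le_sum fun s _ => ?_
          rw [← Finset.sum_filter, Finset.sum_const, nsmul_eq_mul]
          have := card_mem_opSupport_le hloc s
          gcongr
      _ = Z * ∑ s ∈ Λ, Real.exp (-(siteDist s x.1 : ℝ) / w) := by
          rw [← Finset.mul_sum, ← Finset.sum_coe_sort Λ]
      _ ≤ _ := by
          gcongr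
          exact sum_exp_neg_siteDist_div_le hw Λ x.1
  refine (Finset.sum_le_card_nsmul X _ _ hx).trans (le_of_eq ?_)
  rw [nsmul_eq_mul, mul_assoc]

variable {κ : Type*} [DecidableEq κ] {layer : ι → κ}

open Classical in
-- Depth is measured from a site `s` of `h α`. In `exp (L.length + 3)`, the interaction ball
-- accounts for `L.length + 1`, the diameter of the terms meeting `X` for `1` and the interpolation
-- for `1`. The decaying factor at the site of `X` nearest to `s` is enlarged to a double sum, which
-- can be exchanged with the sum over `α`.
lemma norm_lie_heisenberg_taylorRem_le (hloc : IsGeometricallyLocal a Z J h) (ha : 1 ≤ a)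
    (hJ0 : 0 ≤ J)
    (hlayer : ∀ α β, layer α = layer β → Commute (h α) (h β)) {X : Finset Λ} {O : SpinOp Λ q}
    (hO : IsSupportedOn O X) (L : List (κ × ℝ)) (p : ℕ) {t τ u : ℝ} (ht : 0 ≤ t) (htτ : t ≤ τ)
    (hu : 0 ≤ u) (α : ι) :
    ‖⁅heisenberg (∑ α, h α) t O, taylorRem p (termGenerator h layer α L) u⁆‖
      ≤ 2 * ‖O‖ * (J * formulaWeight L
          * (2 * (J * ((2 * (L.length * a) + 1) ^ d * Z)) * formulaWeight L) ^ p * u ^ p)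
        * (X.card * Real.exp (L.length + 3))
        * ∑ x ∈ X, ∑ s with s ∈ opSupport (h α),
          Real.exp (-(siteDist s.1 x.1 : ℝ) / (liebRobinsonVelocity a Z J * τ + a)) := by
  have hh : ∀ α, IsSelfAdjoint (h α) := hloc.hermitian
  have hH : IsSelfAdjoint (∑ α, h α) := isSelfAdjoint_finset_sum hh
  have hadj : ∀ α β, ¬ Overlap h α β → Commute (h α) (h β) := fun α β hab =>
    commute_of_opSupport_inter_empty hab
  have hw := formulaWeight_nonneg L
  have hgl := localTo_termGenerator hh hlayer hadj α L
  have hgc : ContDiff ℝ (⊤ : ℕ∞) (termGenerator h layer α L) :=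
    (derivBound_termGenerator hh hlayer hadj hloc.norm_le hJ0 α L le_rfl).contDiff
  have hBl : ∀ W, (∀ β ∈ interactionBall (Overlap h) α L.length, Commute W (h β)) →
      Commute W (taylorRem p (termGenerator h layer α L) u) := fun W hW =>
    Commute.taylorRem_right hgc (hgl W hW) p u
  rcases X.eq_empty_or_nonempty with rfl | hX
  · have hcen : ∀ W, Commute O W := fun W =>
      hO.commute (isSupportedOn_univ W) (Finset.disjoint_empty_left _)
    rw [heisenberg_eq_self hH (hcen _), lie_eq_zero_of_commute (hcen _)]
    simp
  by_cases hα : (opSupport (h α)).Nonempty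
  swap
  · have hz : ⁅heisenberg (∑ α, h α) t O, taylorRem p (termGenerator h layer α L) u⁆ = 0 := by
      -- A term with empty support overlaps nothing, not even itself: its interaction ball is `{α}`,
      -- and `h α` is central.
      refine lie_eq_zero_of_commute (hBl _ fun β hβ => ?_)
      have hemp : ∀ m, ∀ β ∈ interactionBall (Overlap h) α m, β = α := by
        intro m
        induction m with
        | zero => intro β hβ; simpa [interactionBall] using hβ
        | succ m ih =>
          intro β hβ
          simp only [interactionBall, thicken, Finset.mem_filter, Finset.mem_univ, true_and] at hβ
          rcases hβ with hβ | ⟨γ, hγ, v, hv, _⟩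
          · exact ih β hβ
          · rw [ih γ hγ] at hv
            exact (hα ⟨v, hv⟩).elim
      rw [hemp _ β hβ]
      exact (commute_of_opSupport_empty hα _).symm
    rw [hz, norm_zero]
    have hs : 0 ≤ ∑ x ∈ X, ∑ s with s ∈ opSupport (h α),
        Real.exp (-(siteDist s.1 x.1 : ℝ) / (liebRobinsonVelocity a Z J * τ + a)) :=
      Finset.sum_nonneg fun _ _ => Finset.sum_nonneg fun _ _ => (Real.exp_pos _).le
    positivity
  obtain ⟨s, hs⟩ := id hα
  set B := taylorRem p (termGenerator h layer α L) u with hBdef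
  set N : ℝ := (2 * (L.length * a) + 1) ^ d * Z with hN
  have hcard : ((interactionBall (Overlap h) α L.length).card : ℝ) ≤ N := by
    rw [hN]
    exact_mod_cast card_interactionBall_le hloc ha hα L.length
  have hBn : ‖B‖ ≤ J * formulaWeight L * (2 * (J * N) * formulaWeight L) ^ p * u ^ p := by
    have hdb := derivBound_termGenerator hh hlayer hadj hloc.norm_le hJ0 α L hcard
    exact norm_taylorRem_le p hgc (hdb.bound p) hu
  obtain ⟨x₀, hx₀, hmin⟩ := Finset.exists_min_image X (fun x => siteDist s.1 x.1) hX
  have hτ : 0 ≤ τ := ht.trans htτ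
  have ha0 : (0 : ℝ) < a := by exact_mod_cast ha
  have hXc : (1 : ℝ) ≤ X.card := by exact_mod_cast hX.card_pos
  set S : Finset ι := X.biUnion fun v => Finset.univ.filter fun β => v ∈ opSupport (h β) with hSdef
  have hScard : (S.card : ℝ) ≤ X.card * Z := by
    exact_mod_cast Finset.card_biUnion_le_card_mul _ _ Z fun v _ => card_mem_opSupport_le hloc v
  have hSmem : ∀ β, β ∈ S ↔ ∃ v ∈ X, v ∈ opSupport (h β) := fun β => by simp [hSdef]
  -- A term meeting `X` may reach one diameter closer to `s` than `X` does, hence the `- 1` in `d₀`.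
  have hLR := norm_lie_heisenberg_le_of_localTo (B := B) (O := O) (S := S) (n := X.card)
    (d₀ := (siteDist s.1 x₀.1 : ℝ) / a - 1)
    hh hadj hJ0 hloc.norm_le (card_overlap_le hloc) (supportDepth_lipschitz hloc ha s)
    (supportDepth_nonpos hs) hBl hXc hScard (fun β hβ => ?_) (fun β hβ => ?_) ht
  · have htriv : ‖⁅heisenberg (∑ α, h α) t O, B⁆‖ ≤ 2 * ‖O‖ * ‖B‖ := by
      refine (norm_lie_le _ _).trans (le_of_eq ?_)
      rw [norm_heisenberg hH]
    have hc0 : 0 ≤ liebRobinsonVelocity a Z J * τ := by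
      rw [liebRobinsonVelocity]; positivity
    have hk : 1 ≤ (X.card : ℝ) * Real.exp (L.length + 2) :=
      one_le_mul_of_one_le_of_one_le hXc (Real.one_le_exp (by positivity))
    have hint := le_mul_exp_of_le_of_le (r := (siteDist s.1 x₀.1 : ℝ)) (by positivity) hk hc0 ha0
      htriv ?_
    · refine hint.trans ?_
      have h1 : Real.exp (-(siteDist s.1 x₀.1 : ℝ) / (liebRobinsonVelocity a Z J * τ + a))
          ≤ ∑ x ∈ X, ∑ s with s ∈ opSupport (h α),
            Real.exp (-(siteDist s.1 x.1 : ℝ) / (liebRobinsonVelocity a Z J * τ + a)) := by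
        refine le_trans ?_ (Finset.single_le_sum (f := fun x : Λ =>
          ∑ s with s ∈ opSupport (h α),
            Real.exp (-(siteDist s.1 x.1 : ℝ) / (liebRobinsonVelocity a Z J * τ + a)))
          (fun _ _ => Finset.sum_nonneg fun _ _ => (Real.exp_pos _).le) hx₀)
        exact Finset.single_le_sum (f := fun s : Λ =>
          Real.exp (-(siteDist s.1 x₀.1 : ℝ) / (liebRobinsonVelocity a Z J * τ + a)))
          (fun _ _ => (Real.exp_pos _).le) (by simpa using hs)
      have h2 : Real.exp (L.length + 3 : ℝ) = Real.exp (L.length + 2) * Real.exp 1 := by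
        rw [← Real.exp_add]; ring_nf
      rw [h2]
      calc _ = 2 * ‖O‖ * ‖B‖ * (X.card * (Real.exp (L.length + 2) * Real.exp 1))
            * Real.exp (-(siteDist s.1 x₀.1 : ℝ) / (liebRobinsonVelocity a Z J * τ + a)) := by
            ring
        _ ≤ _ := by gcongr
    · refine hLR.trans ?_
      have h3 : 4 * Real.exp 1 * J * Z * t ≤ liebRobinsonVelocity a Z J * τ / a := by
        rw [liebRobinsonVelocity, le_div_iff₀ ha0]
        calc 4 * Real.exp 1 * J * Z * t * a = 4 * Real.exp 1 * J * Z * a * t := by ring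
          _ ≤ _ := by gcongr
      have h4 : Real.exp (L.length + 1 - ((siteDist s.1 x₀.1 : ℝ) / a - 1))
          * Real.exp (4 * Real.exp 1 * J * Z * t) ≤ Real.exp (L.length + 2)
          * Real.exp ((liebRobinsonVelocity a Z J * τ - siteDist s.1 x₀.1) / a) := by
        rw [← Real.exp_add, ← Real.exp_add, Real.exp_le_exp, sub_div]
        linarith
      calc _ = 2 * ‖O‖ * ‖B‖ * X.card
            * (Real.exp (L.length + 1 - ((siteDist s.1 x₀.1 : ℝ) / a - 1))
              * Real.exp (4 * Real.exp 1 * J * Z * t)) := by ring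
        _ ≤ 2 * ‖O‖ * ‖B‖ * X.card * (Real.exp (L.length + 2)
          * Real.exp ((liebRobinsonVelocity a Z J * τ - siteDist s.1 x₀.1) / a)) := by gcongr
        _ = _ := by ring
  · obtain ⟨v, hvX, hv⟩ := (hSmem β).1 hβ
    obtain ⟨w, hw, hws⟩ := exists_supportDepth_eq (a := a) s ⟨v, hv⟩
    rw [hws]
    have h1 := siteDist_div_le (z := s.1) ha (hloc.diam_le β v hv w hw)
    have h2 : (siteDist s.1 x₀.1 : ℝ) / a ≤ (siteDist v.1 s.1 : ℝ) / a := by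
      rw [siteDist_comm v.1 s.1]
      gcongr
      exact hmin v hvX
    linarith
  · exact (commute_of_opSupport_disjoint hO fun v hv hvX => hβ ((hSmem β).2 ⟨v, hvX, hv⟩)).symm

open Classical in
lemma norm_lie_heisenberg_productGenerator_sub_le (hloc : IsGeometricallyLocal a Z J h)
    (ha : 1 ≤ a)
    (hJ0 : 0 ≤ J)
    (hlayer : ∀ α β, layer α = layer β → Commute (h α) (h β)) {X : Finset Λ} {O : SpinOp Λ q}
    (hO : IsSupportedOn O X) (L : List (κ × ℝ)) {p : ℕ} (hp : 1 ≤ p)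
    (hL : ∀ k ≤ p, iteratedDeriv k (productFormula (layerSum h layer) L) 0
      = ((-Complex.I) • ∑ α, h α) ^ k)
    {t τ u ε : ℝ} (ht : 0 ≤ t) (htτ : t ≤ τ) (hu : 0 ≤ u) (huε : u ≤ ε) :
    ‖⁅heisenberg (∑ α, h α) t O, productGenerator (layerSum h layer) L u - ∑ α, h α⁆‖
      ≤ 2 * ‖O‖ * (J * formulaWeight L
          * (2 * (J * ((2 * (L.length * a) + 1) ^ d * Z)) * formulaWeight L) ^ p * ε ^ p)
        * (X.card * Real.exp (L.length + 3))
        * (X.card * Z * (3 * (liebRobinsonVelocity a Z J * τ + a)) ^ d) := by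
  have hh : ∀ α, IsSelfAdjoint (h α) := hloc.hermitian
  have hadj : ∀ α β, ¬ Overlap h α β → Commute (h α) (h β) := fun α β hab =>
    commute_of_opSupport_inter_empty hab
  have hw := formulaWeight_nonneg L
  have hτ : 0 ≤ τ := ht.trans htτ
  have hLS : ∀ r, IsSelfAdjoint (layerSum h layer r) := fun r => isSelfAdjoint_finset_sum hh
  have hgc : ∀ α, ContDiff ℝ (⊤ : ℕ∞) (termGenerator h layer α L) := fun α =>
    (derivBound_termGenerator hh hlayer hadj hloc.norm_le hJ0 α L le_rfl).contDiff
  -- The difference equals its own remainder by the order condition; `1 ≤ p` removes the constant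
  -- Hamiltonian from it, and what is left splits over `α`.
  have hR : productGenerator (layerSum h layer) L u - ∑ α, h α
      = ∑ α, taylorRem p (termGenerator h layer α L) u := by
    rw [← taylorRem_eq_self (iteratedDeriv_productGenerator_sub hLS hL) u,
      taylorRem_sub p (contDiff_productGenerator L) contDiff_const, taylorRem_const hp, sub_zero,
      ← taylorRem_sum p Finset.univ fun α _ => hgc α]
    congr 1
    funext s
    exact productGenerator_eq_sum h layer L s
  have hwd : (1 : ℝ) ≤ liebRobinsonVelocity a Z J * τ + a := by
    have h1 : (1 : ℝ) ≤ a := by exact_mod_cast ha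
    have h2 : 0 ≤ liebRobinsonVelocity a Z J * τ := by
      rw [liebRobinsonVelocity]; positivity
    linarith
  have hlie : ∀ y : SpinOp Λ q, ⁅y, ∑ α, taylorRem p (termGenerator h layer α L) u⁆
      = ∑ α, ⁅y, taylorRem p (termGenerator h layer α L) u⁆ := fun y => by
    simp only [Ring.lie_def, Finset.sum_mul, Finset.mul_sum, Finset.sum_sub_distrib]
  rw [hR, hlie]
  refine (norm_sum_le _ _).trans ?_
  refine (Finset.sum_le_sum fun α _ =>
    norm_lie_heisenberg_taylorRem_le hloc ha hJ0 hlayer hO L p ht htτ hu α).trans ?_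
  rw [← Finset.mul_sum]
  have hsum := sum_sum_exp_neg_siteDist_le hloc hwd X
  have hs : 0 ≤ ∑ α, ∑ x ∈ X, ∑ s with s ∈ opSupport (h α),
      Real.exp (-(siteDist s.1 x.1 : ℝ) / (liebRobinsonVelocity a Z J * τ + a)) :=
    Finset.sum_nonneg fun _ _ => Finset.sum_nonneg fun _ _ =>
      Finset.sum_nonneg fun _ _ => (Real.exp_pos _).le
  have hε : 0 ≤ ε := hu.trans huε
  gcongr

end Geometry

/-! ### The error of a product formula in a local expectation value -/

section TrotterError

lemma trotterProduct_eq_productFormula {n : Type} [Fintype n] [DecidableEq n] {K M : ℕ}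
    (r : Fin M → Fin K) (x : Fin M → ℝ) (H : Fin K → Matrix n n ℂ) :
    trotterProduct r x H = productFormula H (List.ofFn fun j => (r j, x j)) := by
  have key : ∀ (L : List (Fin K × ℝ)) (t : ℝ),
      productFormula H L t = (L.map fun y => evolution (H y.1) (y.2 * t)).prod := by
    intro L t
    induction L with
    | nil => rfl
    | cons y L ih =>
      rw [productFormula, ih, List.map_cons, List.prod_cons]
      rfl
  funext t
  rw [key, List.map_ofFn]
  rfl

lemma trotterError_le_norm {n : Type} [Fintype n] [DecidableEq n] {K M : ℕ}
    (r : Fin M → Fin K) (x : Fin M → ℝ) (H : Fin K → Matrix n n ℂ) (O ρ : Matrix n n ℂ)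
    (hρ : IsDensityMatrix ρ) (τ : ℝ) (T : ℕ) :
    trotterError r x H O ρ τ T ≤
      ‖star (trotterProduct r x H (τ / T) ^ T) * O * trotterProduct r x H (τ / T) ^ T
        - heisenberg (∑ j, H j) τ O‖ := by
  have key : ∀ V : Matrix n n ℂ, (O * (V * ρ * V.conjTranspose)).trace
      = (star V * O * V * ρ).trace := by
    intro V
    rw [Matrix.star_eq_conjTranspose, ← mul_assoc, Matrix.trace_mul_comm]
    simp only [mul_assoc]
  rw [trotterError, key, key, ← Matrix.trace_sub, ← sub_mul]
  exact norm_trace_mul_le hρ.1 hρ.2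

variable {d : ℕ} {Λ : Finset (Fin d → ℤ)} {q : Λ → ℕ} {ι : Type} [Fintype ι]
  {h : ι → SpinOp Λ q} {a Z K M : ℕ} {J : ℝ}

lemma trotterError_le_of_isGeometricallyLocal (hloc : IsGeometricallyLocal a Z J h) (ha : 1 ≤ a)
    (hJ0 : 0 ≤ J) {layer : ι → Fin K}
    (hlayer : ∀ α β, layer α = layer β → Commute (h α) (h β)) {X : Finset Λ} {O ρ : SpinOp Λ q}
    (hO : IsSupportedOn O X) (hρ : IsDensityMatrix ρ) {r : Fin M → Fin K} {x : Fin M → ℝ} {p : ℕ}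
    (hp : 1 ≤ p) (hrx : IsTrotterFormula p r x) {τ : ℝ} {T : ℕ} (hτ : 0 ≤ τ) (hT : 1 ≤ T) :
    trotterError r x (layerHamiltonian h layer) O ρ τ T
      ≤ τ * (2 * ‖O‖ * (J * (∑ j, |x j|)
          * (2 * (J * ((2 * (M * a) + 1) ^ d * Z)) * ∑ j, |x j|) ^ p * (τ / T) ^ p)
        * (X.card * Real.exp (M + 3))
        * (X.card * Z * (3 * (liebRobinsonVelocity a Z J * τ + a)) ^ d)) := by
  have hh : ∀ α, IsSelfAdjoint (h α) := hloc.hermitian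
  have hLS : ∀ j, IsSelfAdjoint (layerSum h layer j) := fun j => isSelfAdjoint_finset_sum hh
  set L : List (Fin K × ℝ) := List.ofFn fun j => (r j, x j) with hL
  have hlen : L.length = M := by simp [hL]
  have hwt : formulaWeight L = ∑ j, |x j| := by
    rw [formulaWeight, hL, List.map_ofFn, List.sum_ofFn]
    rfl
  have hsum : ∑ j, layerSum h layer j = ∑ α, h α :=
    Finset.sum_fiberwise Finset.univ layer h
  have hS : trotterProduct r x (layerSum h layer) = productFormula (layerSum h layer) L :=
    trotterProduct_eq_productFormula r x _
  have hder : ∀ k ≤ p, iteratedDeriv k (productFormula (layerSum h layer) L) 0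
      = ((-Complex.I) • ∑ α, h α) ^ k := by
    intro k hk
    rw [← hS, ← hsum]
    exact hrx _ (layerSum h layer) hLS k hk
  have hT0 : (0 : ℝ) < T := by exact_mod_cast hT
  have hmul : (T : ℝ) * (τ / T) = τ := by field_simp
  have hpow := norm_productFormula_pow_conj_sub_le (O := O) (τ := τ) (ε := τ / T) hLS
    (isSelfAdjoint_finset_sum (s := Finset.univ) hh) L (by positivity)
    (fun u hu huε v hv hvτ => norm_lie_heisenberg_productGenerator_sub_le hloc ha hJ0 hlayer hO L
      hp hder hv hvτ hu huε) T (s := 0) le_rfl (by rw [zero_add, hmul])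
  rw [zero_add, hmul, heisenberg_zero, hlen, hwt] at hpow
  refine (trotterError_le_norm r x _ O ρ hρ τ T).trans (le_trans (le_of_eq ?_) hpow)
  rw [show layerHamiltonian h layer = layerSum h layer from rfl, hsum, hS]

end TrotterError

/-- The constant in the error bound for a product formula with coefficients `x` of order `p`. -/
noncomputable def trotterConstant (d p : ℕ) {M : ℕ} (x : Fin M → ℝ) : ℝ :=
  2 * (∑ j, |x j|) * (2 * (2 * M + 1) ^ d * ∑ j, |x j|) ^ p * Real.exp (M + 3) * 3 ^ d

lemma trotterConstant_nonneg (d p : ℕ) {M : ℕ} (x : Fin M → ℝ) : 0 ≤ trotterConstant d p x := by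
  have : 0 ≤ ∑ j, |x j| := Finset.sum_nonneg fun _ _ => abs_nonneg _
  rw [trotterConstant]
  positivity

/-- The factor `J Z a ^ d` occurs `p + 1` times: `p` times from the size of the interaction balls
and once from the volume sum. Each is at most `c a ^ (d - 1)`, whence the exponent `(d - 1) * (p +
1)`. -/
lemma trotterConstant_bound {d p M a Z T : ℕ} (hd : 1 ≤ d) (ha : 1 ≤ a) {J τ nX nO : ℝ}
    (hJ0 : 0 ≤ J) (hτ : 0 ≤ τ) (hO : 0 ≤ nO) (x : Fin M → ℝ) :
    τ * (2 * nO * (J * (∑ j, |x j|)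
          * (2 * (J * ((2 * (M * a) + 1) ^ d * Z)) * ∑ j, |x j|) ^ p * (τ / T) ^ p)
        * (nX * Real.exp (M + 3))
        * (nX * Z * (3 * (liebRobinsonVelocity a Z J * τ + a)) ^ d))
      ≤ trotterConstant d p x * (a : ℝ) ^ ((d - 1) * (p + 1)) * nX ^ 2 * nO
        * (liebRobinsonVelocity a Z J * τ)
        * (1 + max (liebRobinsonVelocity a Z J * τ) 0) ^ d
        * (liebRobinsonVelocity a Z J * (τ / T)) ^ p := by
  obtain ⟨d, rfl⟩ := Nat.exists_eq_add_of_le' hd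
  have ha1 : (1 : ℝ) ≤ a := by exact_mod_cast ha
  have ha0 : (0 : ℝ) < a := by linarith
  set c := liebRobinsonVelocity a Z J with hc
  have hc0 : 0 ≤ c := by rw [hc, liebRobinsonVelocity]; positivity
  have hW : 0 ≤ ∑ j, |x j| := Finset.sum_nonneg fun _ _ => abs_nonneg _
  set W := ∑ j, |x j|
  have hJZ : J * Z * a ≤ c := by
    rw [hc, liebRobinsonVelocity]
    have h1 : (1 : ℝ) ≤ 4 * Real.exp 1 := by
      have := Real.one_le_exp (zero_le_one (α := ℝ))
      linarith
    have h2 : 0 ≤ J * Z * a := by positivity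
    nlinarith
  have hball : (2 * (M * a) + 1 : ℝ) ^ (d + 1) ≤ (2 * M + 1) ^ (d + 1) * (a : ℝ) ^ (d + 1) := by
    rw [← mul_pow]
    gcongr
    nlinarith
  have hvol : (3 * (c * τ + a)) ^ (d + 1) ≤ 3 ^ (d + 1) * (a : ℝ) ^ (d + 1)
      * (1 + max (c * τ) 0) ^ (d + 1) := by
    have hcτ : 0 ≤ c * τ := by positivity
    rw [← mul_pow, ← mul_pow, max_eq_left hcτ]
    refine pow_le_pow_left₀ (by positivity) ?_ _
    nlinarith
  have hJZ' : J * Z * (a : ℝ) ^ (d + 1) ≤ c * (a : ℝ) ^ d := by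
    rw [pow_succ']
    calc J * Z * (a * (a : ℝ) ^ d) = (J * Z * a) * (a : ℝ) ^ d := by ring
      _ ≤ _ := by gcongr
  have hterm : 2 * (J * ((2 * (M * a) + 1) ^ (d + 1) * Z)) * W
      ≤ (2 * (2 * M + 1) ^ (d + 1) * W) * (c * (a : ℝ) ^ d) := by
    calc 2 * (J * ((2 * (M * a) + 1) ^ (d + 1) * Z)) * W
        ≤ 2 * (J * (((2 * M + 1) ^ (d + 1) * (a : ℝ) ^ (d + 1)) * Z)) * W := by gcongr
      _ = (2 * (2 * M + 1) ^ (d + 1) * W) * (J * Z * (a : ℝ) ^ (d + 1)) := by ring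
      _ ≤ _ := by gcongr
  calc τ * (2 * nO * (J * W * (2 * (J * ((2 * (M * a) + 1) ^ (d + 1) * Z)) * W) ^ p * (τ / T) ^ p)
        * (nX * Real.exp (M + 3)) * (nX * Z * (3 * (c * τ + a)) ^ (d + 1)))
      = nX ^ 2 * (τ * (2 * nO * (W * (2 * (J * ((2 * (M * a) + 1) ^ (d + 1) * Z)) * W) ^ p
        * (τ / T) ^ p) * Real.exp (M + 3) * (J * Z * (3 * (c * τ + a)) ^ (d + 1)))) := by ring
    _ ≤ nX ^ 2 * (τ * (2 * nO * (W * ((2 * (2 * M + 1) ^ (d + 1) * W) * (c * (a : ℝ) ^ d)) ^ p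
        * (τ / T) ^ p) * Real.exp (M + 3) * (J * Z * (3 ^ (d + 1) * (a : ℝ) ^ (d + 1)
          * (1 + max (c * τ) 0) ^ (d + 1))))) := by gcongr
    _ = nX ^ 2 * (τ * (2 * nO * (W * ((2 * (2 * M + 1) ^ (d + 1) * W) * (c * (a : ℝ) ^ d)) ^ p
        * (τ / T) ^ p) * Real.exp (M + 3) * (3 ^ (d + 1) * (J * Z * (a : ℝ) ^ (d + 1))
          * (1 + max (c * τ) 0) ^ (d + 1)))) := by ring
    _ ≤ nX ^ 2 * (τ * (2 * nO * (W * ((2 * (2 * M + 1) ^ (d + 1) * W) * (c * (a : ℝ) ^ d)) ^ p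
        * (τ / T) ^ p) * Real.exp (M + 3) * (3 ^ (d + 1) * (c * (a : ℝ) ^ d)
          * (1 + max (c * τ) 0) ^ (d + 1)))) := by
        have : 0 ≤ max (c * τ) 0 := le_max_right _ _
        gcongr
    _ = _ := by
        have hTC : trotterConstant (d + 1) p x = 2 * W * (2 * (2 * M + 1) ^ (d + 1) * W) ^ p
          * Real.exp (M + 3) * 3 ^ (d + 1) := rfl
        rw [hTC, Nat.add_sub_cancel, mul_add_one, pow_add (a : ℝ), pow_mul (a : ℝ)]
        simp only [mul_pow]
        ring

lemma one_add_max_mul_pow_le {c τ : ℝ} (hc : 0 ≤ c) (hτ : 1 ≤ τ) (d : ℕ) :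
    (1 + max (c * τ) 0) ^ d ≤ (1 + c) ^ d * τ ^ d := by
  rw [max_eq_left (by positivity), ← mul_pow]
  gcongr
  nlinarith

theorem lemma1 (d : ℕ) (hd : 1 ≤ d) :
    ∃ ν : ℝ → ℝ, Monotone ν ∧ (ν =O[Filter.atTop] fun l : ℝ => l ^ d) ∧
      ∀ (p K M : ℕ) (r : Fin M → Fin K) (x : Fin M → ℝ), 1 ≤ p → IsTrotterFormula p r x →
        ∃ C : ℝ, ∀ (a Z : ℕ) (J : ℝ), 1 ≤ a → 0 ≤ J →
          ∃ C' τ₀ : ℝ, ∀ (Λ : Finset (Fin d → ℤ)) (q : Λ → ℕ) (ι : Type) [Fintype ι]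
            (h : ι → SpinOp Λ q) (layer : ι → Fin K),
            IsGeometricallyLocal a Z J h →
            (∀ α β, layer α = layer β → Commute (h α) (h β)) →
            ∀ (X : Finset Λ) (O ρ : SpinOp Λ q), O.IsHermitian → IsSupportedOn O X →
              IsDensityMatrix ρ →
              ∀ (τ : ℝ) (T : ℕ), 0 ≤ τ → 1 ≤ T →
                trotterError r x (layerHamiltonian h layer) O ρ τ T
                  ≤ C * (a : ℝ) ^ ((d - 1) * (p + 1)) * (X.card : ℝ) ^ 2 * ‖O‖
                    * (liebRobinsonVelocity a Z J * τ) * ν (liebRobinsonVelocity a Z J * τ)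
                    * (liebRobinsonVelocity a Z J * (τ / T)) ^ p ∧
                (τ₀ < τ →
                  trotterError r x (layerHamiltonian h layer) O ρ τ T
                    ≤ C' * (X.card : ℝ) ^ 2 * ‖O‖ * τ ^ (d + 1) * (τ / T) ^ p ∧
                  trotterError r x (layerHamiltonian h layer) O ρ τ T
                    ≤ C' * (X.card : ℝ) ^ 2 * ‖O‖ * (τ ^ (d + p + 1) / (T : ℝ) ^ p)) := by
  -- The maximum keeps the function monotone on the negative axis, where `(1 + l) ^ d` is not for
  -- even `d`.
  refine ⟨fun l => (1 + max l 0) ^ d, fun l l' hl => ?_, ?_, ?_⟩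
  · have : 0 ≤ max l 0 := le_max_right _ _
    dsimp only
    gcongr
  · refine Asymptotics.IsBigO.of_bound (2 ^ d) ?_
    filter_upwards [Filter.eventually_ge_atTop 1] with l hl
    have hl0 : 0 ≤ l := by linarith
    rw [max_eq_left hl0, Real.norm_of_nonneg (by positivity), Real.norm_of_nonneg (by positivity),
      ← mul_pow]
    gcongr
    linarith
  · intro p K M r x hp hrx
    refine ⟨trotterConstant d p x, fun a Z J ha hJ0 => ?_⟩
    set c := liebRobinsonVelocity a Z J with hc
    have hc0 : 0 ≤ c := by rw [hc, liebRobinsonVelocity]; positivity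
    have hC := trotterConstant_nonneg d p x
    -- The threshold `1` suffices since `1 + c τ ≤ (1 + c) τ` for `τ ≥ 1`.
    refine ⟨trotterConstant d p x * (a : ℝ) ^ ((d - 1) * (p + 1)) * c ^ (p + 1) * (1 + c) ^ d, 1,
      fun Λ q ι _ h layer hloc hlayer X O ρ _ hO hρ τ T hτ hT => ?_⟩
    have hmain := (trotterError_le_of_isGeometricallyLocal hloc ha hJ0 hlayer hO hρ hp hrx hτ
      hT).trans (trotterConstant_bound hd ha hJ0 hτ (norm_nonneg O) x)
    rw [← hc] at hmain
    refine ⟨hmain, fun hτ1 => ?_⟩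
    have h1 : trotterError r x (layerHamiltonian h layer) O ρ τ T
        ≤ trotterConstant d p x * (a : ℝ) ^ ((d - 1) * (p + 1)) * c ^ (p + 1) * (1 + c) ^ d
          * (X.card : ℝ) ^ 2 * ‖O‖ * τ ^ (d + 1) * (τ / T) ^ p := by
      refine hmain.trans ?_
      have hν := one_add_max_mul_pow_le hc0 hτ1.le d
      calc _ ≤ trotterConstant d p x * (a : ℝ) ^ ((d - 1) * (p + 1)) * (X.card : ℝ) ^ 2 * ‖O‖
            * (c * τ) * ((1 + c) ^ d * τ ^ d) * (c * (τ / T)) ^ p := by gcongr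
        _ = _ := by
            rw [mul_pow c]
            ring
    refine ⟨h1, h1.trans (le_of_eq ?_)⟩
    rw [div_pow, mul_assoc _ (τ ^ (d + 1)), ← mul_div_assoc, ← pow_add]
    congr 3
    ring
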